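/- Let $\bar r,\bar a,\underline d,\bar d$ be constants with $\underline d>0$. There is a constant $C$, depending only on $\bar r,\bar a,\underline d,\bar d$, such that the following holds for all $m,n\in\mathbb N^+$. Let $\mathcal D=\{(r_j,\boldsymbol a_j)\}_{j=1}^n$, with $r_j\in\mathbb R$, $\boldsymbol a_j=(a_{1j},\dots,a_{mj})^\top\in\mathbb R^m$, $|r_j|\le\bar r$ and $\|\boldsymbol a_j\|_\infty\le\bar a$ for all $j$ (the data need not be nonnegative), and let $\boldsymbol d\in\mathbb R^m$ with $\underline d\le d_i\le\bar d$ for all $i$, and $\boldsymbol b=n\boldsymbol d$. Assume that the data are in general position: for every price vector $\boldsymbol p\ge\boldsymbol 0$ there are at most $m$ indices $j$ with $\boldsymbol a_j^\top\boldsymbol p=r_j$. Let $$R_n^*=\max\Big\{\sum_{j=1}^n r_jx_j:\ \sum_{j=1}^n a_{ij}x_j\le b_i\ (1\le i\le m),\ 0\le x_j\le1\Big\}.$$ The columns arrive in a uniformly random order, i.e. the column arriving at time $t$ is $(r_{\sigma(t)},\boldsymbol a_{\sigma(t)})$ for a uniformly random permutation $\sigma$ of $\{1,\dots,n\}$. The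 Dynamic Learning Algorithm starts with $\boldsymbol p_1=\boldsymbol 0$; at time $t=1,\dots,n$ it sets $x_t=1$ if $r_{\sigma(t)}>\boldsymbol a_{\sigma(t)}^\top\boldsymbol p_t$ and $x_t=0$ otherwise, and then it chooses, as a function of the $t$ columns observed so far, an optimal solution of the scaled dual problem $$\boldsymbol p_{t+1}\in\operatorname*{arg\,min}_{\boldsymbol p\ge\boldsymbol 0}\ \boldsymbol d^\top\boldsymbol p+\frac1t\sum_{j=1}^t\big(r_{\sigma(j)}-\boldsymbol a_{\sigma(j)}^\top\boldsymbol p\big)^+ .$$ Then, however these optimal solutions are chosen, $R_n=\sum_{t=1}^n r_{\sigma(t)}x_t$ satisfies $$R_n^*-\mathbb E[R_n]\le C\sqrt{mn},$$ and, if $n\ge2$, the expected constraint violation satisfies, componentwise, $$\mathbb E\Big[\sum_{t=1}^n a_{i\sigma(t)}x_t-b_i\Big]\le C\sqrt{mn}\,\log n\qquad(1\le i\le m).$$ Both expectations are over the random permutation $\sigma$. -/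

import Mathlib

open scoped BigOperators

namespace OnlineLP

/-- One column of the linear program: the reward `r_j` together with the constraint
coefficients `a_j = (a_{1j}, …, a_{mj})`. -/
abbrev Column (m : ℕ) : Type := ℝ × (Fin m → ℝ)

/-- The inner product `a_jᵀ p` of the coefficients of a column with a price vector. -/
def cost {m : ℕ} (c : Column m) (p : Fin m → ℝ) : ℝ := ∑ i, c.2 i * p i

/-- The feasible set of the LP relaxation: `A x ≤ b`, `0 ≤ x ≤ 1`. -/
def primalFeasible {m n : ℕ} (z : Fin n → Column m) (b : Fin m → ℝ) : Set (Fin n → ℝ) :=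
  {x | (∀ j, 0 ≤ x j ∧ x j ≤ 1) ∧ ∀ i, ∑ j, (z j).2 i * x j ≤ b i}

/-- The optimal value `max rᵀ x` of the LP relaxation. For `b ≥ 0` the feasible set is compact and
contains `0`, so that the supremum is a maximum. -/
noncomputable def primalValue {m n : ℕ} (z : Fin n → Column m) (b : Fin m → ℝ) : ℝ :=
  sSup ((fun x : Fin n → ℝ => ∑ j, (z j).1 * x j) '' primalFeasible z b)

/-- The objective of the scaled dual problem of the first `t` columns,
`dᵀ p + (1/t) ∑_{j ≤ t} (r_j - a_jᵀ p)⁺`. -/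
noncomputable def dualObjective {m t : ℕ} (d : Fin m → ℝ) (z : Fin t → Column m)
    (p : Fin m → ℝ) : ℝ :=
  ∑ i, d i * p i + (1 / (t : ℝ)) * ∑ j, max ((z j).1 - cost (z j) p) 0

/-- `p` is an optimal solution of the scaled dual problem, i.e. it minimizes the dual objective
over the nonnegative orthant. -/
def IsDualOptimal {m t : ℕ} (d : Fin m → ℝ) (z : Fin t → Column m) (p : Fin m → ℝ) : Prop :=
  (∀ i, 0 ≤ p i) ∧
    ∀ q : Fin m → ℝ, (∀ i, 0 ≤ q i) → dualObjective d z p ≤ dualObjective d z q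

/-- A solver for the scaled dual problems: to each nonempty history of observed columns it
assigns an optimal dual solution (with an arbitrary choice among several optimal ones). -/
def IsDualSolver {m : ℕ} (d : Fin m → ℝ)
    (solve : (t : ℕ) → (Fin t → Column m) → (Fin m → ℝ)) : Prop :=
  ∀ (t : ℕ) (z : Fin t → Column m), 1 ≤ t → IsDualOptimal d z (solve t z)

/-- The dual price that the Dynamic Learning Algorithm uses in the period `t`, where the
periods are numbered from `0`: the price is `0` in the first period and afterwards the optimal
dual solution for the `t` columns that arrived before. -/
def dlaPrice {m n : ℕ} (solve : (t : ℕ) → (Fin t → Column m) → (Fin m → ℝ))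
    (z : Fin n → Column m) (t : Fin n) : Fin m → ℝ :=
  if t.val = 0 then 0 else solve t.val (fun j => z (Fin.castLE t.isLt.le j))

open Classical in
/-- The output of the Dynamic Learning Algorithm on the columns `z` in their order of arrival:
`x_t = 1` if `r_t > a_tᵀ p_t` and `x_t = 0` otherwise. -/
noncomputable def dlaOutput {m n : ℕ} (solve : (t : ℕ) → (Fin t → Column m) → (Fin m → ℝ))
    (z : Fin n → Column m) (t : Fin n) : ℝ :=
  if cost (z t) (dlaPrice solve z t) < (z t).1 then 1 else 0

/-- The reward `R_n = ∑_t r_t x_t` collected by the Dynamic Learning Algorithm. -/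
noncomputable def dlaReward {m n : ℕ} (solve : (t : ℕ) → (Fin t → Column m) → (Fin m → ℝ))
    (z : Fin n → Column m) : ℝ :=
  ∑ t, (z t).1 * dlaOutput solve z t

/-- The vector `A x - b` for the output `x` of the Dynamic Learning Algorithm. -/
noncomputable def dlaExcess {m n : ℕ} (solve : (t : ℕ) → (Fin t → Column m) → (Fin m → ℝ))
    (z : Fin n → Column m) (b : Fin m → ℝ) (i : Fin m) : ℝ :=
  ∑ t, (z t).2 i * dlaOutput solve z t - b i

open Classical in
/-- The columns are in general position: for each price vector `p ≥ 0` at most `m` of them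
satisfy `a_jᵀ p = r_j`. -/
def GeneralPosition {m n : ℕ} (z : Fin n → Column m) : Prop :=
  ∀ p : Fin m → ℝ, (∀ i, 0 ≤ p i) →
    (Finset.univ.filter fun j => cost (z j) p = (z j).1).card ≤ m

end OnlineLP

/-! Fix a period with t ≥ 1 past arrivals and let p be its price, an optimal dual solution for them;
let W bound the data. First-order optimality of p in the directions e_i and -p shows that on the
past arrivals the threshold rule at p consumes on average at most d_i and earns on average at least
the sample dual value, up to ties. General position makes the share of ties at most min(m, t)/t ≤
√(m/t). By weak duality the sample dual value is at least what any feasible x of the full program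
earns on the sample, minus ‖p‖₁ ≤ W/dlow times the Euclidean deviation of the sample consumption of
x, which is O(√(m/t)) in expectation.

It remains to pass from the past arrivals to the next one (`abs_expect_average_sub_next_le`). Given
p, the later arrivals are exchangeable, so blocks of k = min(t, n - t) past and future arrivals may
be compared. Swapping partners at random turns the difference into Rademacher sums over threshold
decisions. These have VC dimension at most m, and chaining over Dudley's packing numbers gives
O(√(mk)) without a logarithm (`expect_rademacher_le_of_vcDim`). Since the swaps also change p, that
bound is stated for an arbitrary selection depending on the signs.

Each period thus loses O(√m (1/√(t+1) + 1/√(n-t))), which sums to O(√(mn)) for reward and violation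
alike; the factor log n in the second bound is slack. -/

namespace OnlineLP

open Finset

/-! ### Packing numbers of families of finite VC dimension -/

section Packing

variable {ι : Type*} [DecidableEq ι]

/-- Sauer–Shelah in exponential form: the traces of a family of VC dimension at most `m` on a
set `Y`. -/
theorem card_le_of_injOn_inter (𝒜 : Finset (Finset ι)) (m : ℕ)
    (hV : ∀ L : Finset ι, 𝒜.Shatters L → #L ≤ m) (Y : Finset ι)
    (hY : Set.InjOn (fun A => A ∩ Y) (𝒜 : Set (Finset ι))) {x : ℝ} (hx : 0 < x) (hx1 : x ≤ 1) :
    (#𝒜 : ℝ) * x ^ m ≤ (1 + x) ^ #Y := by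
  set ℬ := 𝒜.image (fun A => A ∩ Y) with hℬ
  have hcard : #𝒜 = #ℬ := (Finset.card_image_of_injOn hY).symm
  have hsub : ∀ L ∈ ℬ.shatterer, L ⊆ Y ∧ #L ≤ m := by
    intro L hL
    rw [mem_shatterer] at hL
    have hLY : L ⊆ Y := by
      obtain ⟨u, hu, h⟩ := hL (Finset.Subset.refl L)
      rw [hℬ, mem_image] at hu
      obtain ⟨A, -, rfl⟩ := hu
      intro a ha
      rw [← h] at ha
      simp only [mem_inter] at ha
      exact ha.2.2
    refine ⟨hLY, hV L ?_⟩
    intro t ht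
    obtain ⟨u, hu, h⟩ := hL ht
    rw [hℬ, mem_image] at hu
    obtain ⟨A, hA, rfl⟩ := hu
    refine ⟨A, hA, ?_⟩
    rw [← h]
    ext a
    simp only [mem_inter]
    constructor
    · rintro ⟨h1, h2⟩; exact ⟨h1, h2, hLY h1⟩
    · rintro ⟨h1, h2, -⟩; exact ⟨h1, h2⟩
  have h1 : (#𝒜 : ℝ) ≤ #ℬ.shatterer := by
    rw [hcard]; exact_mod_cast card_le_card_shatterer ℬ
  -- Weighting each shattered set L by x^|L| ≥ x^m and then summing over all subsets of Y replaces
  -- the usual estimate of binomial sums.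
  calc (#𝒜 : ℝ) * x ^ m ≤ #ℬ.shatterer * x ^ m := by gcongr
    _ = ∑ L ∈ ℬ.shatterer, x ^ m := by simp
    _ ≤ ∑ L ∈ ℬ.shatterer, x ^ #L :=
        sum_le_sum fun L hL => pow_le_pow_of_le_one hx.le hx1 (hsub L hL).2
    _ ≤ ∑ L ∈ Y.powerset, x ^ #L :=
        sum_le_sum_of_subset_of_nonneg (fun L hL => mem_powerset.2 (hsub L hL).1)
          (fun _ _ _ => by positivity)
    _ = (x + 1) ^ #Y := by
        rw [← Finset.sum_pow_mul_eq_add_pow]; simp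
    _ = (1 + x) ^ #Y := by rw [add_comm]

variable [Fintype ι]

/-- If few sample points suffice, some sample separates all members of a separated family. -/
theorem exists_sample_injOn (𝒜 : Finset (Finset ι)) {δ : ℝ}
    (hsep : ∀ A ∈ 𝒜, ∀ B ∈ 𝒜, A ≠ B → δ * Fintype.card ι ≤ #(symmDiff A B))
    (hne : 0 < Fintype.card ι) (h𝒜 : 𝒜.Nonempty) (q : ℕ)
    (hq : 2 * Real.log #𝒜 ≤ δ * q) :
    ∃ Y : Finset ι, #Y ≤ q ∧ Set.InjOn (fun A => A ∩ Y) (𝒜 : Set (Finset ι)) := by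
  by_contra hcon
  push Not at hcon
  set N := Fintype.card ι
  have hN : (0 : ℝ) < N := by exact_mod_cast hne
  have hA : (0 : ℝ) < #𝒜 := by exact_mod_cast h𝒜.card_pos
  -- Union bound by counting: every sequence of q points misses the symmetric difference of some
  -- pair, but one pair is missed by at most (N e^{-δ})^q sequences.
  have hbad : ∀ f : Fin q → ι, ∃ P ∈ 𝒜.offDiag, ∀ k, f k ∉ symmDiff P.1 P.2 := by
    intro f
    have hc : #(univ.image f) ≤ q := by simpa using card_image_le (s := univ) (f := f)
    have := hcon (univ.image f) hc
    simp only [Set.InjOn, not_forall, exists_prop] at this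
    obtain ⟨A, hA, B, hB, h, hAB⟩ := this
    refine ⟨(A, B), mem_offDiag.2 ⟨hA, hB, hAB⟩, fun k hk => ?_⟩
    have hk' : f k ∈ univ.image f := mem_image_of_mem _ (mem_univ _)
    have := Finset.ext_iff.1 h (f k)
    simp only [mem_inter, hk', and_true] at this
    rw [mem_symmDiff] at hk
    tauto
  have hcount : (univ : Finset (Fin q → ι)) ⊆ 𝒜.offDiag.biUnion
      (fun P => Fintype.piFinset fun _ : Fin q => (symmDiff P.1 P.2)ᶜ) := by
    intro f _
    obtain ⟨P, hP, h⟩ := hbad f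
    exact mem_biUnion.2 ⟨P, hP, Fintype.mem_piFinset.2 fun k => mem_compl.2 (h k)⟩
  have h1 : ((N : ℝ)) ^ q ≤ ∑ P ∈ 𝒜.offDiag, (N * Real.exp (-δ)) ^ q := by
    have h2 := (card_le_card hcount).trans card_biUnion_le
    have h3 : ((N : ℝ)) ^ q ≤ ∑ P ∈ 𝒜.offDiag, ((#(symmDiff P.1 P.2)ᶜ : ℕ) : ℝ) ^ q := by
      have : N ^ q ≤ ∑ P ∈ 𝒜.offDiag, (#(symmDiff P.1 P.2)ᶜ) ^ q := by
        simpa [N] using h2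
      exact_mod_cast this
    refine h3.trans (sum_le_sum fun P hP => ?_)
    rw [mem_offDiag] at hP
    refine pow_le_pow_left₀ (by positivity) ?_ q
    rw [card_compl, Nat.cast_sub (card_le_univ _)]
    have := hsep P.1 hP.1 P.2 hP.2.1 hP.2.2
    have he : 1 - δ ≤ Real.exp (-δ) := by have := Real.add_one_le_exp (-δ); linarith
    nlinarith
  rw [sum_const, nsmul_eq_mul, mul_pow, ← Real.exp_nat_mul] at h1
  have hexp : Real.exp (q * -δ) ≤ 1 / (#𝒜 : ℝ) ^ 2 := by
    rw [one_div, ← Real.exp_log (by positivity : (0 : ℝ) < (#𝒜 : ℝ) ^ 2), ← Real.exp_neg]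
    apply Real.exp_le_exp.2
    rw [Real.log_pow]; push_cast; linarith
  have hoff : (#𝒜.offDiag : ℝ) < (#𝒜 : ℝ) ^ 2 := by
    have : #𝒜.offDiag < #𝒜 * #𝒜 := by
      rw [offDiag_card]
      have := h𝒜.card_pos
      have : 0 < #𝒜 * #𝒜 := by positivity
      omega
    rw [sq]; exact_mod_cast this
  have h4 : (#𝒜.offDiag : ℝ) * ((N : ℝ) ^ q * Real.exp (q * -δ)) < (N : ℝ) ^ q := by
    have hNq : (0 : ℝ) < (N : ℝ) ^ q := by positivity
    calc (#𝒜.offDiag : ℝ) * ((N : ℝ) ^ q * Real.exp (q * -δ))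
        < (#𝒜 : ℝ) ^ 2 * ((N : ℝ) ^ q * Real.exp (q * -δ)) := by gcongr
      _ ≤ (#𝒜 : ℝ) ^ 2 * ((N : ℝ) ^ q * (1 / (#𝒜 : ℝ) ^ 2)) := by gcongr
      _ = (N : ℝ) ^ q := by field_simp
  linarith

/-- Dudley's packing bound for families of finite VC dimension. -/
theorem log_card_le_of_separated (𝒜 : Finset (Finset ι)) (m : ℕ)
    (hV : ∀ L : Finset ι, 𝒜.Shatters L → #L ≤ m) {δ : ℝ} (hδ : 0 < δ) (hδ1 : δ ≤ 1)
    (hsep : ∀ A ∈ 𝒜, ∀ B ∈ 𝒜, A ≠ B → δ * Fintype.card ι ≤ #(symmDiff A B))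
    (hne : 0 < Fintype.card ι) (h𝒜 : 𝒜.Nonempty) :
    Real.log #𝒜 ≤ 2 * m * Real.log (4 / δ) + 1 / 2 := by
  have hA : (0 : ℝ) < #𝒜 := by exact_mod_cast h𝒜.card_pos
  have hA1 : (1 : ℝ) ≤ #𝒜 := by exact_mod_cast h𝒜.card_pos
  have hL : 0 ≤ Real.log #𝒜 := Real.log_nonneg hA1
  set q := ⌈2 * Real.log #𝒜 / δ⌉₊
  have hq1 : 2 * Real.log #𝒜 / δ ≤ q := Nat.le_ceil _
  have hq2 : (q : ℝ) < 2 * Real.log #𝒜 / δ + 1 := Nat.ceil_lt_add_one (by positivity)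
  obtain ⟨Y, hYq, hY⟩ := exists_sample_injOn 𝒜 hsep hne h𝒜 q
    (by rw [div_le_iff₀ hδ] at hq1; linarith)
  -- With x = δ/4 the factor (1 + x)^q costs only half of log |𝒜|, up to a constant, and is absorbed
  -- on the left.
  have h := card_le_of_injOn_inter 𝒜 m hV Y hY (x := δ / 4) (by positivity) (by linarith)
  have h2 : (#𝒜 : ℝ) * (δ / 4) ^ m ≤ Real.exp (δ / 4 * q) := by
    refine h.trans ?_
    calc (1 + δ / 4) ^ #Y ≤ (1 + δ / 4) ^ q := pow_le_pow_right₀ (by linarith) hYq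
      _ ≤ Real.exp (δ / 4) ^ q :=
          pow_le_pow_left₀ (by positivity) (by linarith [Real.add_one_le_exp (δ / 4)]) _
      _ = Real.exp (δ / 4 * q) := by rw [← Real.exp_nat_mul, mul_comm]
  have h3 := Real.log_le_log (by positivity) h2
  rw [Real.log_exp, Real.log_mul hA.ne' (by positivity), Real.log_pow] at h3
  have h4 : Real.log (δ / 4) = - Real.log (4 / δ) := by
    rw [← Real.log_inv, inv_div]
  have h5 : δ / 4 * q ≤ Real.log #𝒜 / 2 + 1 / 4 := by
    have : δ / 4 * q ≤ δ / 4 * (2 * Real.log #𝒜 / δ + 1) := by gcongr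
    have h6 : δ / 4 * (2 * Real.log #𝒜 / δ + 1) = Real.log #𝒜 / 2 + δ / 4 := by
      field_simp; ring
    linarith
  rw [h4] at h3
  linarith

end Packing

/-! ### Rademacher sums and chaining -/

/-- The sign encoded by a Boolean. -/
def sgn (b : Bool) : ℝ := if b then 1 else -1

section Rademacher

variable {ι : Type*} [Fintype ι] [DecidableEq ι]

/-- By independence the moment generating function is the product of the cosh (c k), and cosh u ≤
exp (u²/2). -/
theorem expect_exp_rademacher_le (c : ι → ℝ) :
    𝔼 ε : ι → Bool, Real.exp (∑ k, sgn (ε k) * c k) ≤ Real.exp ((∑ k, c k ^ 2) / 2) := by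
  have h1 : ∑ ε : ι → Bool, Real.exp (∑ k, sgn (ε k) * c k) = ∏ k, (2 * Real.cosh (c k)) := by
    have : ∀ k, 2 * Real.cosh (c k) = ∑ b : Bool, Real.exp (sgn b * c k) := by
      intro k; simp [sgn, Real.cosh_eq]; ring
    simp_rw [this, Finset.prod_univ_sum, Real.exp_sum, Fintype.piFinset_univ]
  rw [Fintype.expect_eq_sum_div_card, h1, prod_mul_distrib]
  have h2 : ((Fintype.card (ι → Bool) : ℕ) : ℝ) = ∏ _k : ι, (2 : ℝ) := by simp
  rw [h2, mul_div_cancel_left₀ _ (by positivity), sum_div, Real.exp_sum]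
  exact prod_le_prod (fun k _ => (Real.cosh_pos _).le) fun k _ => Real.cosh_le_exp_half_sq _

/-- Maximal inequality for finitely many Rademacher sums, stated for a random selection. -/
theorem expect_rademacher_le_sqrt {J : Type*} (T : Finset J) (c : J → ι → ℝ) {s l : ℝ}
    (hs : 0 < s) (hl : 0 < l) (hT : Real.log (2 * #T) ≤ l) (hc : ∀ j ∈ T, ∑ k, c j k ^ 2 ≤ s)
    (sel : (ι → Bool) → J) (hsel : ∀ ε, sel ε ∈ T) :
    𝔼 ε : ι → Bool, |∑ k, sgn (ε k) * c (sel ε) k| ≤ Real.sqrt (2 * s * l) := by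
  -- This λ balances the two terms of (l + λ²s/2)/λ.
  set lam := Real.sqrt (2 * l / s) with hlam
  have hlam0 : 0 < lam := Real.sqrt_pos.2 (by positivity)
  have hlam2 : lam ^ 2 = 2 * l / s := Real.sq_sqrt (by positivity)
  have hTpos : 0 < #T := card_pos.2 ⟨_, hsel fun _ => true⟩
  have hTpos' : (0 : ℝ) < #T := by exact_mod_cast hTpos
  set C := l + lam ^ 2 * s / 2 with hC
  -- The tangent bound u ≤ C - 1 + exp (u - C) replaces Jensen's inequality for the logarithm; C is
  -- chosen so that the exponential term has mean at most 1.
  have hpt : ∀ ε : ι → Bool, lam * |∑ k, sgn (ε k) * c (sel ε) k| ≤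
      C - 1 + Real.exp (-C) * ∑ j ∈ T, (Real.exp (∑ k, sgn (ε k) * (lam * c j k)) +
        Real.exp (∑ k, sgn (ε k) * (-lam * c j k))) := by
    intro ε
    have e1 : ∀ (a : ℝ) j, ∑ k, sgn (ε k) * (a * c j k) = a * ∑ k, sgn (ε k) * c j k := by
      intro a j; rw [mul_sum]; exact sum_congr rfl fun k _ => by ring
    simp_rw [e1]
    set X := fun j => ∑ k, sgn (ε k) * c j k
    have h1 : Real.exp (lam * |X (sel ε)|) ≤
        ∑ j ∈ T, (Real.exp (lam * X j) + Real.exp (-lam * X j)) := by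
      refine le_trans ?_ (single_le_sum (f := fun j => Real.exp (lam * X j) +
        Real.exp (-lam * X j)) (fun j _ => by positivity) (hsel ε))
      have p1 := Real.exp_pos (lam * X (sel ε))
      have p2 := Real.exp_pos (-lam * X (sel ε))
      rcases abs_cases (X (sel ε)) with ⟨h, -⟩ | ⟨h, -⟩ <;> rw [h]
      · linarith
      · rw [show lam * -X (sel ε) = -lam * X (sel ε) by ring]; linarith
    have h2 := Real.add_one_le_exp (lam * |X (sel ε)| - C)
    have h3 : Real.exp (lam * |X (sel ε)| - C) =
        Real.exp (-C) * Real.exp (lam * |X (sel ε)|) := by rw [← Real.exp_add]; ring_nf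
    have h4 := mul_le_mul_of_nonneg_left h1 (Real.exp_pos (-C)).le
    show lam * |X (sel ε)| ≤ _
    linarith
  have hmgf : ∀ j ∈ T, ∀ a : ℝ, a ^ 2 = lam ^ 2 →
      𝔼 ε : ι → Bool, Real.exp (∑ k, sgn (ε k) * (a * c j k)) ≤ Real.exp (lam ^ 2 * s / 2) := by
    intro j hj a ha
    refine (expect_exp_rademacher_le fun k => a * c j k).trans (Real.exp_le_exp.2 ?_)
    have : ∑ k, (a * c j k) ^ 2 = lam ^ 2 * ∑ k, c j k ^ 2 := by
      rw [mul_sum]; exact sum_congr rfl fun k _ => by rw [mul_pow, ha]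
    rw [this]
    have := hc j hj
    gcongr
  have h1 : lam * 𝔼 ε : ι → Bool, |∑ k, sgn (ε k) * c (sel ε) k| ≤
      C - 1 + Real.exp (-C) * ∑ j ∈ T, (Real.exp (lam ^ 2 * s / 2) + Real.exp (lam ^ 2 * s / 2)) := by
    rw [mul_expect]
    refine (expect_le_expect fun ε _ => hpt ε).trans ?_
    rw [expect_add_distrib, Fintype.expect_const, ← mul_expect, expect_sum_comm]
    gcongr with j hj
    rw [expect_add_distrib]
    exact add_le_add (hmgf j hj lam rfl) (hmgf j hj (-lam) (by ring))
  have h2 : Real.exp (-C) * ∑ j ∈ T, (Real.exp (lam ^ 2 * s / 2) + Real.exp (lam ^ 2 * s / 2)) ≤ 1 := by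
    rw [sum_const, nsmul_eq_mul]
    have h3 : (#T : ℝ) * (Real.exp (lam ^ 2 * s / 2) + Real.exp (lam ^ 2 * s / 2)) =
        (2 * #T) * Real.exp (lam ^ 2 * s / 2) := by ring
    have h4 : (2 * #T : ℝ) ≤ Real.exp l := by
      rw [← Real.log_le_iff_le_exp (by positivity)]; exact hT
    calc _ ≤ Real.exp (-C) * (Real.exp l * Real.exp (lam ^ 2 * s / 2)) := by
          rw [h3]; gcongr
      _ = 1 := by rw [← Real.exp_add, ← Real.exp_add, hC]; simp
  have h5 : lam * 𝔼 ε : ι → Bool, |∑ k, sgn (ε k) * c (sel ε) k| ≤ 2 * l := by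
    have : lam ^ 2 * s / 2 = l := by rw [hlam2]; field_simp
    linarith
  have h6 : lam * Real.sqrt (2 * s * l) = 2 * l := by
    rw [hlam, ← Real.sqrt_mul (by positivity), show 2 * l / s * (2 * s * l) = (2 * l) ^ 2 by
      field_simp, Real.sqrt_sq (by positivity)]
  rw [← h6] at h5
  exact le_of_mul_le_mul_left h5 hlam0

/-- Maximal separated subfamilies are nets. -/
theorem exists_separated_net (𝒜 : Finset (Finset ι)) (r : ℝ) (hr : 0 ≤ r) :
    ∃ ℬ ⊆ 𝒜, (∀ A ∈ ℬ, ∀ B ∈ ℬ, A ≠ B → r < #(symmDiff A B)) ∧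
      ∀ A ∈ 𝒜, ∃ B ∈ ℬ, (#(symmDiff A B) : ℝ) ≤ r := by
  classical
  let F := 𝒜.powerset.filter fun ℬ => ∀ A ∈ ℬ, ∀ B ∈ ℬ, A ≠ B → r < #(symmDiff A B)
  have hF : F.Nonempty := ⟨∅, by simp [F]⟩
  obtain ⟨ℬ, hℬ, hmax⟩ := exists_max_image F card hF
  simp only [F, mem_filter, mem_powerset] at hℬ hmax
  refine ⟨ℬ, hℬ.1, hℬ.2, fun A hA => ?_⟩
  by_contra hcon
  push Not at hcon
  have hAB : A ∉ ℬ := fun h => by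
    have := hcon A h
    simp at this
    linarith
  have := hmax (insert A ℬ) ⟨insert_subset hA hℬ.1, ?_⟩
  · rw [card_insert_of_notMem hAB] at this; omega
  · intro P hP Q hQ hPQ
    rw [mem_insert] at hP hQ
    rcases hP with rfl | hP <;> rcases hQ with rfl | hQ
    · exact absurd rfl hPQ
    · exact hcon _ hQ
    · rw [symmDiff_comm]; exact hcon _ hP
    · exact hℬ.2 P hP Q hQ hPQ

theorem sum_sq_indicator_sub_le (w : ι → ℝ) (hw : ∀ k, |w k| ≤ 1) (A B : Finset ι) :
    ∑ k, ((if k ∈ A then w k else 0) - (if k ∈ B then w k else 0)) ^ 2 ≤ #(symmDiff A B) := by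
  calc _ ≤ ∑ k, (if k ∈ symmDiff A B then (1 : ℝ) else 0) := by
        refine sum_le_sum fun k _ => ?_
        have h := hw k
        have h1 : w k ^ 2 ≤ 1 := (sq_le_one_iff_abs_le_one _).2 h
        by_cases hA : k ∈ A <;> by_cases hB : k ∈ B <;> simp [hA, hB, mem_symmDiff, h1]
    _ = #(symmDiff A B) := by simp

/-- Chaining: the expected supremum of a weighted Rademacher process over a family of sets of
VC dimension at most `m`, stated for a random selection from the family. -/
theorem expect_rademacher_le_of_vcDim (𝒜 : Finset (Finset ι)) (m : ℕ) (hm : 1 ≤ m)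
    (hV : ∀ L : Finset ι, 𝒜.Shatters L → #L ≤ m) (w : ι → ℝ) (hw : ∀ k, |w k| ≤ 1)
    (hne : 0 < Fintype.card ι) (sel : (ι → Bool) → Finset ι) (hsel : ∀ ε, sel ε ∈ 𝒜) :
    𝔼 ε : ι → Bool, |∑ k, sgn (ε k) * (if k ∈ sel ε then w k else 0)| ≤
      20 * Real.sqrt (m * Fintype.card ι) := by
  set N := Fintype.card ι
  have hN : (0 : ℝ) < N := by exact_mod_cast hne
  have hm' : (1 : ℝ) ≤ m := by exact_mod_cast hm
  choose net hsub hsep hnet using fun k : ℕ =>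
    exists_separated_net 𝒜 (N * (1 / 4 : ℝ) ^ k) (by positivity)
  have hlog : ∀ k, (net k).Nonempty → Real.log (2 * #(net k)) ≤ 4 * m * (k + 1) := by
    intro k hk
    have hVk : ∀ L : Finset ι, (net k).Shatters L → #L ≤ m := fun L hL =>
      hV L (hL.mono_left (hsub k))
    have hd := log_card_le_of_separated (net k) m hVk (δ := (1 / 4 : ℝ) ^ k) (by positivity)
      (pow_le_one₀ (by norm_num) (by norm_num))
      (fun A hA B hB hAB => by rw [mul_comm]; exact (hsep k A hA B hB hAB).le) hne hk
    have hc : (0 : ℝ) < #(net k) := by exact_mod_cast hk.card_pos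
    have h4 : Real.log (4 / (1 / 4 : ℝ) ^ k) = (k + 1) * (2 * Real.log 2) := by
      have : (4 / (1 / 4 : ℝ) ^ k) = 2 ^ (2 * (k + 1)) := by
        rw [pow_mul, one_div_pow, div_div_eq_mul_div, pow_succ]; norm_num; ring
      rw [this, Real.log_pow]; push_cast; ring
    rw [h4] at hd
    rw [Real.log_mul (by norm_num) hc.ne']
    -- The constant 4 just suffices: 4 log 2 + log 2 + 1/2 < 4.
    have h2 := Real.log_two_lt_d9
    have h3 : (1 : ℝ) ≤ m * (k + 1) := by
      have : (0 : ℝ) ≤ k := by positivity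
      nlinarith
    nlinarith
  -- The last factor is the closed form of 1 + ∑_{i<k} (i + 2) 2^{-i}: the coarsest net contributes
  -- 1 and the link from level i to i + 1 contributes (i + 2) 2^{-i}.
  have hstep : ∀ k : ℕ, ∀ sel : (ι → Bool) → Finset ι, (∀ ε, sel ε ∈ net k) →
      𝔼 ε : ι → Bool, |∑ i, sgn (ε i) * (if i ∈ sel ε then w i else 0)| ≤
        Real.sqrt (8 * m * N) * (7 - (k + 3) * 2 * (1 / 2 : ℝ) ^ k) := by
    intro k
    induction k with
    | zero =>
      intro sel hsel
      refine (expect_rademacher_le_sqrt (net 0) (fun A i => if i ∈ A then w i else 0) hN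
        (l := 4 * m) (by positivity) ?_ ?_ sel hsel).trans ?_
      · simpa using hlog 0 ⟨_, hsel fun _ => true⟩
      · intro A _
        refine le_trans (by simpa using sum_sq_indicator_sub_le w hw A ∅) ?_
        exact_mod_cast card_le_univ (symmDiff A ∅)
      · rw [show (2 * N * (4 * m) : ℝ) = 8 * m * N by ring]; norm_num
    | succ k ih =>
      intro sel hsel
      -- The coarse approximation π A is a function of A, so the link ranges over only |net (k+1)|
      -- increments, each of squared norm at most N 4^{-k}.
      choose! π hπ hπd using hnet k
      have hmem : ∀ ε, sel ε ∈ 𝒜 := fun ε => hsub _ (hsel ε)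
      have h1 := ih (fun ε => π (sel ε)) fun ε => hπ _ (hmem ε)
      have h2 := expect_rademacher_le_sqrt (net (k + 1))
        (fun A i => (if i ∈ A then w i else 0) - (if i ∈ π A then w i else 0))
        (s := N * (1 / 4 : ℝ) ^ k) (l := 4 * m * (k + 2)) (by positivity) (by positivity)
        (by
          have := hlog (k + 1) ⟨_, hsel fun _ => true⟩
          push_cast at this
          linarith)
        (fun A hA => (sum_sq_indicator_sub_le w hw A (π A)).trans (hπd A (hsub _ hA))) sel hsel
      have h3 : Real.sqrt (2 * (N * (1 / 4 : ℝ) ^ k) * (4 * m * (k + 2))) ≤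
          Real.sqrt (8 * m * N) * ((k + 2) * (1 / 2 : ℝ) ^ k) := by
        have e : 2 * (N * (1 / 4 : ℝ) ^ k) * (4 * m * (k + 2)) =
            (8 * m * N) * ((k + 2) * ((1 / 2 : ℝ) ^ k) ^ 2) := by
          rw [← pow_mul, mul_comm k 2, pow_mul]; norm_num; ring
        rw [e, Real.sqrt_mul (by positivity), Real.sqrt_mul (x := (k : ℝ) + 2) (by positivity),
          Real.sqrt_sq (by positivity)]
        gcongr
        rw [Real.sqrt_le_left (by positivity)]
        have : (0 : ℝ) ≤ k := by positivity
        nlinarith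
      calc 𝔼 ε : ι → Bool, |∑ i, sgn (ε i) * (if i ∈ sel ε then w i else 0)|
          ≤ 𝔼 ε : ι → Bool, (|∑ i, sgn (ε i) * (if i ∈ π (sel ε) then w i else 0)| +
            |∑ i, sgn (ε i) * ((if i ∈ sel ε then w i else 0) -
              (if i ∈ π (sel ε) then w i else 0))|) := by
            refine expect_le_expect fun ε _ => ?_
            refine le_trans (le_of_eq ?_) (abs_add_le _ _)
            rw [← sum_add_distrib]
            congr 1
            exact sum_congr rfl fun i _ => by ring
        _ ≤ _ := by
            rw [expect_add_distrib]
            refine (add_le_add h1 (h2.trans h3)).trans (le_of_eq ?_)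
            push_cast
            rw [pow_succ]
            ring
  -- At a radius below 1 the net is the whole family, so the chain ends without a remainder.
  obtain ⟨K, hK⟩ := exists_pow_lt_of_lt_one (show (0 : ℝ) < 1 / N by positivity)
    (show (1 / 4 : ℝ) < 1 by norm_num)
  have hall : ∀ A ∈ 𝒜, A ∈ net K := by
    intro A hA
    obtain ⟨B, hB, hd⟩ := hnet K A hA
    have : (#(symmDiff A B) : ℝ) < 1 := by
      refine hd.trans_lt ?_
      rw [lt_div_iff₀ hN] at hK
      linarith
    have h0 : #(symmDiff A B) = 0 := by
      have : #(symmDiff A B) < 1 := by exact_mod_cast this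
      omega
    rw [card_eq_zero, ← bot_eq_empty, symmDiff_eq_bot] at h0
    rwa [h0]
  refine (hstep K sel fun ε => hall _ (hsel ε)).trans ?_
  have h8 : Real.sqrt (8 * m * N) ≤ (20 / 7) * Real.sqrt (m * N) := by
    rw [mul_assoc, Real.sqrt_mul (by norm_num)]
    gcongr
    rw [Real.sqrt_le_left (by norm_num)]; norm_num
  have h9 : (0 : ℝ) ≤ (K + 3) * 2 * (1 / 2 : ℝ) ^ K := by positivity
  nlinarith [Real.sqrt_nonneg (8 * m * N : ℝ)]

end Rademacher

/-! ### Threshold decisions as a class of VC dimension at most m -/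

open Classical in
/-- The decision on a column at a given price: `1` if the column is accepted and `0` otherwise. -/
noncomputable def accept {m : ℕ} (c : Column m) (p : Fin m → ℝ) : ℝ :=
  if cost c p < c.1 then 1 else 0

theorem accept_nonneg {m : ℕ} (c : Column m) (p : Fin m → ℝ) : 0 ≤ accept c p := by
  unfold accept; split_ifs <;> norm_num

theorem accept_le_one {m : ℕ} (c : Column m) (p : Fin m → ℝ) : accept c p ≤ 1 := by
  unfold accept; split_ifs <;> norm_num

section Halfspaces

variable {ι : Type*} [Fintype ι] [DecidableEq ι] {m : ℕ}

open Classical in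
/-- The sets of columns that are accepted at some price. -/
noncomputable def acceptedSets (z : ι → Column m) : Finset (Finset ι) :=
  univ.filter fun A => ∃ p : Fin m → ℝ, A = univ.filter fun j => cost (z j) p < (z j).1

/-- More than m coefficient vectors satisfy a linear relation g, so ∑ g_j (r_j - a_jᵀp) does not
depend on p. Accepting exactly the indices with g_j > 0 makes it nonnegative, accepting those with
g_j < 0 makes it nonpositive, and a nonzero coefficient makes one of the two strict. -/
theorem card_le_of_shatters_acceptedSets (z : ι → Column m) (L : Finset ι)
    (hL : (acceptedSets z).Shatters L) : #L ≤ m := by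
  classical
  by_contra hcard
  push Not at hcard
  have hdep : ¬ LinearIndependent ℝ (fun j : L => (z j).2) := by
    intro h
    have := h.fintype_card_le_finrank
    simp at this
    omega
  rw [Fintype.not_linearIndependent_iff] at hdep
  obtain ⟨g, hg, j0, hj0⟩ := hdep
  have hcost : ∀ p : Fin m → ℝ, ∑ j : L, g j * cost (z j) p = 0 := by
    intro p
    have h1 : ∀ i, ∑ j : L, g j * (z j).2 i = 0 := by
      intro i
      have := congrFun hg i
      simpa using this
    simp_rw [cost, mul_sum]
    rw [sum_comm]
    refine sum_eq_zero fun i _ => ?_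
    simp_rw [← mul_assoc]
    rw [← sum_mul, h1 i, zero_mul]
  have hconst : ∀ p : Fin m → ℝ, ∑ j : L, g j * ((z j).1 - cost (z j) p) =
      ∑ j : L, g j * (z j).1 := by
    intro p
    simp_rw [mul_sub]
    rw [sum_sub_distrib, hcost, sub_zero]
  have hreal : ∀ T ⊆ L, ∃ p : Fin m → ℝ, ∀ j : L, cost (z j) p < (z j).1 ↔ (j : ι) ∈ T := by
    intro T hT
    obtain ⟨A, hA, h⟩ := hL hT
    simp only [acceptedSets, mem_filter, mem_univ, true_and] at hA
    obtain ⟨p, rfl⟩ := hA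
    refine ⟨p, fun j => ?_⟩
    rw [← h]
    simp
  -- Rejected columns may be tied and contribute zero, so strictness needs a positive coefficient;
  -- hence the use for both g and -g.
  have key : ∀ g : L → ℝ, (∀ p : Fin m → ℝ, ∑ j : L, g j * ((z j).1 - cost (z j) p) =
      ∑ j : L, g j * (z j).1) → 0 ≤ ∑ j : L, g j * (z j).1 ∧
      ((∃ j, 0 < g j) → 0 < ∑ j : L, g j * (z j).1) := by
    intro g hconst
    obtain ⟨p, hp⟩ := hreal ((univ.filter fun j : L => 0 < g j).image Subtype.val) (by
      intro j hj
      simp only [mem_image, mem_filter] at hj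
      obtain ⟨a, -, rfl⟩ := hj
      exact a.2)
    have hp' : ∀ j : L, cost (z j) p < (z j).1 ↔ 0 < g j := by
      intro j; rw [hp]; simp
    rw [← hconst p]
    have hterm : ∀ j : L, 0 ≤ g j * ((z j).1 - cost (z j) p) := by
      intro j
      by_cases h : 0 < g j
      · exact mul_nonneg h.le (by linarith [(hp' j).2 h])
      · have := mt (hp' j).1 h
        push Not at h this
        exact mul_nonneg_of_nonpos_of_nonpos h (by linarith)
    refine ⟨sum_nonneg fun j _ => hterm j, ?_⟩
    rintro ⟨j, hj⟩
    exact sum_pos' (fun j _ => hterm j)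
      ⟨j, mem_univ _, mul_pos hj (by linarith [(hp' j).2 hj])⟩
  have hneg : ∑ j : L, (-g j) * (z j).1 = - ∑ j : L, g j * (z j).1 := by
    rw [← sum_neg_distrib]; exact sum_congr rfl fun j _ => by ring
  have k1 := key g hconst
  have k2 := key (fun j => -g j) fun p => by
    rw [hneg, ← hconst p, ← sum_neg_distrib]; exact sum_congr rfl fun j _ => by ring
  rw [hneg] at k2
  rcases lt_or_gt_of_ne hj0 with h | h
  · have := k2.2 ⟨j0, by simpa using h⟩
    linarith [k1.1]
  · have := k1.2 ⟨j0, h⟩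
    linarith [k2.1]

/-- The Rademacher complexity of threshold decisions, for an arbitrary selection of prices. -/
theorem expect_rademacher_accept_le (hm : 1 ≤ m) (z : ι → Column m) (w : ι → ℝ) {W : ℝ}
    (hW : 0 < W) (hw : ∀ k, |w k| ≤ W) (p : (ι → Bool) → Fin m → ℝ) :
    𝔼 ε : ι → Bool, |∑ k, sgn (ε k) * (w k * accept (z k) (p ε))| ≤
      20 * W * Real.sqrt (m * Fintype.card ι) := by
  classical
  rcases Nat.eq_zero_or_pos (Fintype.card ι) with h0 | hpos
  · have := Fintype.card_eq_zero_iff.1 h0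
    simp
  have h := expect_rademacher_le_of_vcDim (acceptedSets z) m hm
    (card_le_of_shatters_acceptedSets z) (fun k => w k / W)
    (fun k => by rw [abs_div, abs_of_pos hW]; exact (div_le_one hW).2 (hw k)) hpos
    (fun ε => univ.filter fun j => cost (z j) (p ε) < (z j).1)
    (fun ε => by simp only [acceptedSets, mem_filter, mem_univ, true_and]; exact ⟨_, rfl⟩)
  have e : ∀ ε : ι → Bool, |∑ k, sgn (ε k) * (w k * accept (z k) (p ε))| =
      W * |∑ k, sgn (ε k) * (if k ∈ univ.filter (fun j => cost (z j) (p ε) < (z j).1) then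
        w k / W else 0)| := by
    intro ε
    rw [← abs_of_pos hW, ← abs_mul, abs_of_pos hW, mul_sum]
    congr 1
    refine sum_congr rfl fun k _ => ?_
    simp only [accept, mem_filter, mem_univ, true_and]
    split_ifs
    · field_simp
    · simp
  simp_rw [e]
  rw [← mul_expect, mul_comm 20 W, mul_assoc]
  exact mul_le_mul_of_nonneg_left h hW.le

end Halfspaces

/-! ### From the past arrivals to the next one -/

section Symmetrization

variable {m n : ℕ}

/-- Right multiplication rearranges arrival times; this invariance is the source of all
exchangeability arguments below. -/
theorem expect_comp_mul_right (τ : Equiv.Perm (Fin n)) (f : Equiv.Perm (Fin n) → ℝ) :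
    𝔼 σ : Equiv.Perm (Fin n), f (σ * τ) = 𝔼 σ : Equiv.Perm (Fin n), f σ :=
  Fintype.expect_equiv (Equiv.mulRight τ) _ _ fun _ => rfl

/-- Swapping symmetrization: for prices that may depend on the whole arrival order, the
decisions on two disjoint groups of `k` arrivals agree on average. -/
theorem abs_expect_sum_sub_le (hm : 1 ≤ m) (D : Fin n → Column m) (w : Fin n → ℝ) {W : ℝ}
    (hW : 0 < W) (hw : ∀ k, |w k| ≤ W) {k : ℕ} (e : Fin k × Bool ↪ Fin n)
    (p : Equiv.Perm (Fin n) → Fin m → ℝ) :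
    |𝔼 σ : Equiv.Perm (Fin n), ∑ j : Fin k,
      (w (σ (e (j, true))) * accept (D (σ (e (j, true)))) (p σ) -
        w (σ (e (j, false))) * accept (D (σ (e (j, false)))) (p σ))| ≤
      40 * W * Real.sqrt (m * k) := by
  classical
  -- τ ε exchanges the partners of pair j exactly when ε j is false and fixes every time outside the
  -- pairs.
  set τ : (Fin k → Bool) → Equiv.Perm (Fin n) := fun ε =>
    Equiv.Perm.viaEmbedding (Equiv.prodShear (Equiv.refl (Fin k))
      fun j => if ε j then Equiv.refl Bool else Equiv.boolNot) e with hτ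
  have hτe : ∀ ε j b, τ ε (e (j, b)) = e (j, if ε j then b else !b) := by
    intro ε j b
    rw [hτ]
    simp only [Equiv.Perm.viaEmbedding_apply, Equiv.prodShear_apply, Equiv.refl_apply]
    cases ε j <;> simp
  set H : Equiv.Perm (Fin n) → ℝ := fun σ => ∑ j : Fin k,
      (w (σ (e (j, true))) * accept (D (σ (e (j, true)))) (p σ) -
        w (σ (e (j, false))) * accept (D (σ (e (j, false)))) (p σ)) with hH
  have hHτ : ∀ ε σ, H (σ * τ ε) =
      ∑ j : Fin k, sgn (ε j) * (w (σ (e (j, true))) *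
          accept (D (σ (e (j, true)))) (p (σ * τ ε))) -
        ∑ j : Fin k, sgn (ε j) * (w (σ (e (j, false))) *
          accept (D (σ (e (j, false)))) (p (σ * τ ε))) := by
    intro ε σ
    rw [← sum_sub_distrib]
    refine sum_congr rfl fun j _ => ?_
    simp only [Equiv.Perm.mul_apply, hτe]
    cases ε j <;> (simp [sgn]; try ring)
  -- For fixed σ the columns in the sums are now fixed; ε enters only through the signs and the
  -- price, as the Rademacher bound allows.
  have h1 : 𝔼 σ, H σ = 𝔼 σ, 𝔼 ε : Fin k → Bool, H (σ * τ ε) := by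
    rw [expect_comm]
    simp_rw [expect_comp_mul_right]
    rw [Fintype.expect_const]
  show |𝔼 σ, H σ| ≤ _
  rw [h1]
  refine (abs_expect_le _ _).trans (expect_le univ_nonempty fun σ _ => ?_)
  refine (abs_expect_le _ _).trans ?_
  have r1 := expect_rademacher_accept_le hm (fun j => D (σ (e (j, true))))
    (fun j => w (σ (e (j, true)))) hW (fun j => hw _) (fun ε => p (σ * τ ε))
  have r2 := expect_rademacher_accept_le hm (fun j => D (σ (e (j, false))))
    (fun j => w (σ (e (j, false)))) hW (fun j => hw _) (fun ε => p (σ * τ ε))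
  rw [Fintype.card_fin] at r1 r2
  calc 𝔼 ε : Fin k → Bool, |H (σ * τ ε)| ≤ 𝔼 ε : Fin k → Bool, (_ + _) :=
        expect_le_expect fun ε _ => by rw [hHτ]; exact abs_sub _ _
    _ ≤ _ := by
        rw [expect_add_distrib]
        linarith

/-- The t cyclic shifts of a window of length k cover each index k times. This handles k < t, when
fewer future than past arrivals are available. -/
theorem abs_sum_sub_le_of_windows {t k : ℕ} (ht : 0 < t) (hk : k ≤ t) (ψ : Fin t → ℝ) (c B : ℝ)
    (h : ∀ f : Fin k → Fin t, Function.Injective f → |∑ j, ψ (f j) - k * c| ≤ B) :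
    |k * ∑ i, ψ i - t * (k * c)| ≤ t * B := by
  have : NeZero t := ⟨ht.ne'⟩
  have e : k * ∑ i, ψ i - t * (k * c) =
      ∑ s : Fin t, (∑ j : Fin k, ψ (s + Fin.castLE hk j) - k * c) := by
    rw [sum_sub_distrib, sum_comm]
    have : ∀ j : Fin k, ∑ s : Fin t, ψ (s + Fin.castLE hk j) = ∑ s, ψ s := fun j =>
      Equiv.sum_comp (Equiv.addRight (Fin.castLE hk j)) ψ
    simp [this]
  rw [e]
  refine (abs_sum_le_sum_abs _ _).trans ?_
  refine (sum_le_sum fun s _ => h (fun j => s + Fin.castLE hk j) ?_).trans ?_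
  · intro a b hab
    exact Fin.castLE_injective hk (add_left_cancel hab)
  · simp

/-- For prices that depend on the first `t` arrivals only, the average decision on these arrivals
is close in expectation to the decision on the next arrival. -/
theorem abs_expect_average_sub_next_le (hm : 1 ≤ m) (D : Fin n → Column m) (w : Fin n → ℝ)
    {W : ℝ} (hW : 0 < W) (hw : ∀ k, |w k| ≤ W) (t : Fin n) (ht : 0 < t.val)
    (p : Equiv.Perm (Fin n) → Fin m → ℝ)
    (hp : ∀ σ τ : Equiv.Perm (Fin n), (∀ j < t, τ j = j) → p (σ * τ) = p σ) :
    |(𝔼 σ : Equiv.Perm (Fin n), (1 / (t.val : ℝ)) * ∑ j : Fin t.val,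
        w (σ (Fin.castLE t.isLt.le j)) * accept (D (σ (Fin.castLE t.isLt.le j))) (p σ)) -
      𝔼 σ : Equiv.Perm (Fin n), w (σ t) * accept (D (σ t)) (p σ)| ≤
      40 * W * Real.sqrt m * (1 / Real.sqrt t.val + 1 / Real.sqrt (n - t.val)) := by
  set ψ : Fin n → ℝ := fun i =>
    𝔼 σ : Equiv.Perm (Fin n), w (σ i) * accept (D (σ i)) (p σ) with hψ
  -- Exchanging two times that are not before t leaves the price unchanged.
  have hconst : ∀ i, t ≤ i → ψ i = ψ t := by
    intro i hi
    rw [hψ]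
    show 𝔼 σ : Equiv.Perm (Fin n), w (σ i) * accept (D (σ i)) (p σ) = _
    rw [← expect_comp_mul_right (Equiv.swap t i)]
    refine expect_congr rfl fun σ _ => ?_
    rw [hp σ (Equiv.swap t i) fun j hj =>
      Equiv.swap_apply_of_ne_of_ne hj.ne (hj.trans_le hi).ne]
    simp
  set k := min t.val (n - t.val) with hk
  have hkt : k ≤ t.val := min_le_left _ _
  have hkn : k ≤ n - t.val := min_le_right _ _
  have hk0 : 0 < k := lt_min ht (Nat.sub_pos_of_lt t.isLt)
  have hmain := abs_sum_sub_le_of_windows ht hkt (fun j => ψ (Fin.castLE t.isLt.le j)) (ψ t)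
    (40 * W * Real.sqrt (m * k)) (by
      intro f hf
      -- Each past time in the window is paired with one of the times t, …, t + k - 1.
      let e : Fin k × Bool ↪ Fin n :=
        ⟨fun x => if x.2 then Fin.castLE t.isLt.le (f x.1) else
          ⟨t.val + x.1.val, by have := x.1.isLt; have := t.isLt; omega⟩, by
          rintro ⟨a, b⟩ ⟨a', b'⟩ h
          have hfa := (f a).isLt
          have hfa' := (f a').isLt
          cases b <;> cases b' <;> simp only [Fin.ext_iff, if_true, if_false, Fin.val_castLE,
            Bool.false_eq_true] at h
          · have : a = a' := Fin.ext (by omega)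
            rw [this]
          · omega
          · omega
          · have : a = a' := hf (Fin.ext h)
            rw [this]⟩
      have he := abs_expect_sum_sub_le hm D w hW hw e p
      rw [expect_sum_comm] at he
      simp_rw [expect_sub_distrib] at he
      rw [sum_sub_distrib] at he
      have h2 : ∑ j : Fin k, 𝔼 σ : Equiv.Perm (Fin n),
          w (σ (e (j, false))) * accept (D (σ (e (j, false)))) (p σ) = k * ψ t := by
        have h3 : ∀ j : Fin k, ψ (e (j, false)) = ψ t := fun j =>
          hconst _ (Nat.le_add_right t.val j.val)
        refine (sum_congr rfl fun j _ => h3 j).trans ?_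
        simp
      rw [h2] at he
      exact he)
  have hkr : (0 : ℝ) < k := by exact_mod_cast hk0
  have htr : (0 : ℝ) < t.val := by exact_mod_cast ht
  have hL : 𝔼 σ : Equiv.Perm (Fin n), (1 / (t.val : ℝ)) * ∑ j : Fin t.val,
      w (σ (Fin.castLE t.isLt.le j)) * accept (D (σ (Fin.castLE t.isLt.le j))) (p σ) =
      (1 / (t.val : ℝ)) * ∑ j : Fin t.val, ψ (Fin.castLE t.isLt.le j) := by
    rw [← mul_expect, expect_sum_comm]
  rw [hL]
  show |_ - ψ t| ≤ _
  set S := ∑ j : Fin t.val, ψ (Fin.castLE t.isLt.le j)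
  have e1 : (1 / (t.val : ℝ)) * S - ψ t = (k * S - t.val * (k * ψ t)) / (t.val * k) := by
    field_simp
  rw [e1, abs_div, abs_of_pos (by positivity : (0 : ℝ) < t.val * k), div_le_iff₀ (by positivity)]
  refine hmain.trans ?_
  have h3 : 1 / Real.sqrt k ≤ 1 / Real.sqrt t.val + 1 / Real.sqrt (n - t.val) := by
    rw [hk]
    rcases min_choice t.val (n - t.val) with h | h <;> rw [h]
    · exact le_add_of_nonneg_right (by positivity)
    · rw [Nat.cast_sub t.isLt.le]; exact le_add_of_nonneg_left (by positivity)
  calc (t.val : ℝ) * (40 * W * Real.sqrt (m * k))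
      = 40 * W * Real.sqrt m * (1 / Real.sqrt k) * (t.val * k) := by
        rw [Real.sqrt_mul (by positivity)]
        have : Real.sqrt k ≠ 0 := (Real.sqrt_pos.2 hkr).ne'
        field_simp
        rw [Real.sq_sqrt hkr.le]
    _ ≤ _ := by gcongr

end Symmetrization

/-! ### Optimality conditions and weak duality for the sample dual -/

section Dual

variable {m t : ℕ}

theorem cost_add_smul (c : Column m) (p v : Fin m → ℝ) (s : ℝ) :
    cost c (fun i => p i + s * v i) = cost c p + s * cost c v := by
  simp only [cost, mul_sum]
  rw [← sum_add_distrib]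
  exact sum_congr rfl fun i _ => by ring

open Classical in
/-- The columns that are tied at the price `p`. -/
noncomputable def ties (z : Fin t → Column m) (p : Fin m → ℝ) : Finset (Fin t) :=
  univ.filter fun j => cost (z j) p = (z j).1

open Filter Topology in
/-- First-order optimality along a feasible direction, up to the tied columns. -/
theorem IsDualOptimal.average_cost_le {d : Fin m → ℝ} {z : Fin t → Column m} {p : Fin m → ℝ}
    (hp : IsDualOptimal d z p) (v : Fin m → ℝ)
    (hv : ∀ᶠ s : ℝ in 𝓝[>] 0, ∀ i, 0 ≤ p i + s * v i) :
    (1 / (t : ℝ)) * ∑ j, cost (z j) v * accept (z j) p ≤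
      ∑ i, d i * v i + (1 / (t : ℝ)) * ∑ j ∈ ties z p, |cost (z j) v| := by
  classical
  -- Away from a tie the positive part is affine for small s; at a tie it grows by at most s times
  -- the modulus of the slope. One common s then suffices, without subgradients.
  have hpt : ∀ j, ∀ᶠ s : ℝ in 𝓝[>] 0,
      max ((z j).1 - cost (z j) (fun i => p i + s * v i)) 0 ≤
        max ((z j).1 - cost (z j) p) 0 - s * (cost (z j) v * accept (z j) p) +
          s * (if j ∈ ties z p then |cost (z j) v| else 0) := by
    intro j
    have hcont : Tendsto (fun s : ℝ => cost (z j) p + s * cost (z j) v) (𝓝[>] 0)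
        (𝓝 (cost (z j) p)) := by
      have : ContinuousAt (fun s : ℝ => cost (z j) p + s * cost (z j) v) 0 := by fun_prop
      have h := this.tendsto.mono_left (nhdsWithin_le_nhds (s := Set.Ioi 0))
      simpa using h
    rcases lt_trichotomy (cost (z j) p) (z j).1 with h | h | h
    · filter_upwards [hcont.eventually_lt_const h] with s hs
      rw [cost_add_smul]
      have hj : j ∉ ties z p := by simp [ties, h.ne]
      rw [max_eq_left (by linarith), max_eq_left (by linarith)]
      simp only [accept, h, hj, if_true, if_false]
      linarith
    · filter_upwards [self_mem_nhdsWithin] with s hs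
      have hs : 0 < s := hs
      rw [cost_add_smul]
      have hj : j ∈ ties z p := by simp [ties, h]
      simp only [accept, h, hj, if_true, lt_irrefl, if_false]
      rw [sub_self, max_self, sub_add_cancel_left]
      have h1 := mul_nonneg hs.le (abs_nonneg (cost (z j) v))
      have h2 := mul_le_mul_of_nonneg_left (neg_abs_le (cost (z j) v)) hs.le
      refine max_le ?_ ?_ <;> linarith
    · filter_upwards [hcont.eventually_const_lt h] with s hs
      rw [cost_add_smul]
      have hj : j ∉ ties z p := by simp [ties, h.ne']
      rw [max_eq_right (by linarith), max_eq_right (by linarith)]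
      simp [accept, h.not_gt, hj]
  obtain ⟨s, ⟨hvs, hpts⟩, hs⟩ :=
    ((hv.and (eventually_all.2 hpt)).and self_mem_nhdsWithin).exists
  have hs : 0 < s := hs
  have hopt := hp.2 _ hvs
  unfold dualObjective at hopt
  have h1 := sum_le_sum fun j (_ : j ∈ (univ : Finset (Fin t))) => hpts j
  rw [sum_add_distrib, sum_sub_distrib, ← mul_sum, ← mul_sum, ← sum_filter, filter_mem_eq_inter,
    univ_inter] at h1
  have h2 : ∑ i, d i * (p i + s * v i) = ∑ i, d i * p i + s * ∑ i, d i * v i := by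
    rw [mul_sum, ← sum_add_distrib]; exact sum_congr rfl fun i _ => by ring
  rw [h2] at hopt
  have ht : (0 : ℝ) ≤ 1 / t := by positivity
  have h3 := mul_le_mul_of_nonneg_left h1 ht
  have h4 : s * ((1 / (t : ℝ)) * ∑ j, cost (z j) v * accept (z j) p) ≤
      s * (∑ i, d i * v i + (1 / (t : ℝ)) * ∑ j ∈ ties z p, |cost (z j) v|) := by
    linarith
  exact le_of_mul_le_mul_left h4 hs

/-- The sample consumption at a dual optimal price exceeds the budget only through ties. -/
theorem IsDualOptimal.average_consumption_le {d : Fin m → ℝ} {z : Fin t → Column m}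
    {p : Fin m → ℝ} (hp : IsDualOptimal d z p) {W : ℝ} (i : Fin m)
    (hW : ∀ j, |(z j).2 i| ≤ W) :
    (1 / (t : ℝ)) * ∑ j, (z j).2 i * accept (z j) p ≤ d i + W * (#(ties z p) / t) := by
  classical
  have hc : ∀ c : Column m, cost c (Pi.single i 1) = c.2 i := by
    intro c; simp [cost, Pi.single_apply]
  have h := hp.average_cost_le (Pi.single i 1) (by
    filter_upwards [self_mem_nhdsWithin] with s hs k
    have hs : 0 < s := hs
    have := hp.1 k
    by_cases hk : k = i
    · subst hk; simp; linarith
    · simp [hk, this])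
  simp only [hc] at h
  have h1 : ∑ k, d k * (Pi.single i (1 : ℝ) : Fin m → ℝ) k = d i := by simp [Pi.single_apply]
  rw [h1] at h
  have h2 : ∑ j ∈ ties z p, |(z j).2 i| ≤ #(ties z p) * W := by
    rw [← nsmul_eq_mul]; exact sum_le_card_nsmul _ _ _ fun j _ => hW j
  have h3 := mul_le_mul_of_nonneg_left h2 (by positivity : (0 : ℝ) ≤ 1 / t)
  have h4 : 1 / (t : ℝ) * (#(ties z p) * W) = W * (#(ties z p) / t) := by ring
  linarith

/-- The sample reward at a dual optimal price attains the dual value up to ties. -/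
theorem IsDualOptimal.le_average_reward {d : Fin m → ℝ} {z : Fin t → Column m}
    {p : Fin m → ℝ} (hp : IsDualOptimal d z p) {W : ℝ} (hW : ∀ j, |(z j).1| ≤ W) :
    dualObjective d z p - W * (#(ties z p) / t) ≤
      (1 / (t : ℝ)) * ∑ j, (z j).1 * accept (z j) p := by
  have hc : ∀ c : Column m, cost c (fun i => - p i) = - cost c p := by
    intro c; simp [cost]
  -- Shrinking the price stays feasible for s < 1 and yields the inequality from complementary
  -- slackness that is needed here.
  have h := hp.average_cost_le (fun i => - p i) (by
    filter_upwards [Ioo_mem_nhdsGT (show (0 : ℝ) < 1 by norm_num)] with s hs k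
    have := hp.1 k
    nlinarith [hs.2])
  simp only [hc, abs_neg] at h
  have h2 : ∑ j ∈ ties z p, |cost (z j) p| ≤ #(ties z p) * W := by
    rw [← nsmul_eq_mul]
    refine sum_le_card_nsmul _ _ _ fun j hj => ?_
    simp only [ties, mem_filter, mem_univ, true_and] at hj
    -- At a tie the cost equals the reward, so no bound on the price enters.
    rw [hj]; exact hW j
  have h3 := mul_le_mul_of_nonneg_left h2 (by positivity : (0 : ℝ) ≤ 1 / t)
  have h4 : 1 / (t : ℝ) * (#(ties z p) * W) = W * (#(ties z p) / t) := by ring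
  have h5 : ∑ j, max ((z j).1 - cost (z j) p) 0 =
      ∑ j, (z j).1 * accept (z j) p + ∑ j, -cost (z j) p * accept (z j) p := by
    rw [← sum_add_distrib]
    refine sum_congr rfl fun j _ => ?_
    unfold accept
    split_ifs with hj
    · rw [max_eq_left (by linarith)]; ring
    · rw [max_eq_right (by linarith)]; ring
  have h6 : ∑ i, d i * -p i = - ∑ i, d i * p i := by
    rw [← sum_neg_distrib]; exact sum_congr rfl fun i _ => by ring
  unfold dualObjective
  rw [h5, mul_add]
  linarith

/-- The zero price has dual objective at most W, while the budget term alone is at least dlow times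
the sum of the prices. The bound is independent of m. -/
theorem IsDualOptimal.sum_price_le {d : Fin m → ℝ} {z : Fin t → Column m}
    {p : Fin m → ℝ} (hp : IsDualOptimal d z p) (ht : 0 < t) {W dlow : ℝ}
    (hW : ∀ j, |(z j).1| ≤ W) (hd0 : 0 < dlow) (hd : ∀ i, dlow ≤ d i) :
    ∑ i, p i ≤ W / dlow := by
  have h := hp.2 (fun _ => 0) fun _ => le_rfl
  have ht' : (0 : ℝ) < t := by exact_mod_cast ht
  have h1 : dualObjective d z (fun _ => 0) ≤ W := by
    have hsum : ∑ j, max ((z j).1 - cost (z j) fun _ => 0) 0 ≤ t * W := by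
      have := sum_le_card_nsmul univ (fun j => max ((z j).1 - cost (z j) fun _ => 0) 0) W
        fun j _ => by
          have h0 := abs_nonneg (z j).1
          have h2 := le_abs_self (z j).1
          have h3 := hW j
          simp [cost]
          constructor <;> linarith
      simpa using this
    unfold dualObjective
    have := mul_le_mul_of_nonneg_left hsum (by positivity : (0 : ℝ) ≤ 1 / t)
    have e : 1 / (t : ℝ) * (t * W) = W := by field_simp
    simp only [mul_zero, sum_const_zero, zero_add]
    linarith
  have h2 : dlow * ∑ i, p i ≤ dualObjective d z p := by
    unfold dualObjective
    have h3 : dlow * ∑ i, p i ≤ ∑ i, d i * p i := by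
      rw [mul_sum]
      exact sum_le_sum fun i _ => mul_le_mul_of_nonneg_right (hd i) (hp.1 i)
    have h4 : 0 ≤ (1 / (t : ℝ)) * ∑ j, max ((z j).1 - cost (z j) p) 0 :=
      mul_nonneg (by positivity) (sum_nonneg fun j _ => le_max_right _ _)
    linarith
  rw [le_div_iff₀ hd0]
  linarith

/-- Weak duality for a fractional solution that consumes `c + y` per column with `c ≤ d`. -/
theorem le_dualObjective {d : Fin m → ℝ} {z : Fin t → Column m} {p : Fin m → ℝ}
    (hp : ∀ i, 0 ≤ p i) {x : Fin t → ℝ} (hx : ∀ j, 0 ≤ x j ∧ x j ≤ 1)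
    (y : Fin m → ℝ) (hy : ∀ i, (1 / (t : ℝ)) * ∑ j, (z j).2 i * x j - y i ≤ d i) {P : ℝ}
    (hP : ∑ i, p i ≤ P) :
    (1 / (t : ℝ)) * ∑ j, (z j).1 * x j - P * Real.sqrt (∑ i, y i ^ 2) ≤ dualObjective d z p := by
  have h1 : ∀ j, (z j).1 * x j - cost (z j) p * x j ≤ max ((z j).1 - cost (z j) p) 0 := by
    intro j
    have h1 := le_max_left ((z j).1 - cost (z j) p) 0
    have h2 := le_max_right ((z j).1 - cost (z j) p) 0
    have := hx j
    nlinarith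
  have h2 := mul_le_mul_of_nonneg_left (sum_le_sum fun j (_ : j ∈ univ) => h1 j)
    (by positivity : (0 : ℝ) ≤ 1 / t)
  rw [sum_sub_distrib, mul_sub] at h2
  have h3 : (1 / (t : ℝ)) * ∑ j, cost (z j) p * x j =
      ∑ i, ((1 / (t : ℝ)) * ∑ j, (z j).2 i * x j) * p i := by
    simp_rw [cost, sum_mul, mul_sum, sum_mul]
    rw [sum_comm]
    exact sum_congr rfl fun i _ => sum_congr rfl fun j _ => by ring
  have h4 : ∑ i, ((1 / (t : ℝ)) * ∑ j, (z j).2 i * x j) * p i ≤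
      ∑ i, d i * p i + Real.sqrt (∑ i, y i ^ 2) * ∑ i, p i := by
    rw [mul_sum, ← sum_add_distrib]
    refine sum_le_sum fun i _ => ?_
    rw [← add_mul]
    refine mul_le_mul_of_nonneg_right ?_ (hp i)
    -- The Euclidean norm replaces the maximum because second moments bound its mean by order √m,
    -- which the rate permits.
    have h5 : y i ≤ Real.sqrt (∑ i, y i ^ 2) :=
      Real.le_sqrt_of_sq_le (single_le_sum (f := fun i => y i ^ 2)
        (fun i _ => sq_nonneg _) (mem_univ i))
    linarith [hy i]
  have h6 : Real.sqrt (∑ i, y i ^ 2) * ∑ i, p i ≤ P * Real.sqrt (∑ i, y i ^ 2) := by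
    rw [mul_comm]; exact mul_le_mul_of_nonneg_right hP (Real.sqrt_nonneg _)
  unfold dualObjective
  linarith

end Dual

/-! ### Sampling without replacement -/

section Sampling

variable {n : ℕ}

theorem expect_perm_apply (f : Fin n → ℝ) (i : Fin n) :
    (n : ℝ) * 𝔼 σ : Equiv.Perm (Fin n), f (σ i) = ∑ j, f j := by
  have h : ∀ k, 𝔼 σ : Equiv.Perm (Fin n), f (σ k) = 𝔼 σ : Equiv.Perm (Fin n), f (σ i) := by
    intro k
    rw [← expect_comp_mul_right (Equiv.swap i k)]
    simp
  have h1 : ∑ k, 𝔼 σ : Equiv.Perm (Fin n), f (σ k) = ∑ j, f j := by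
    rw [← expect_sum_comm]
    simp_rw [Equiv.sum_comp]
    rw [Fintype.expect_const]
  rw [← h1, sum_congr rfl fun k _ => h k]
  simp

/-- For fixed i the n - 1 cross terms are equal by exchangeability and, as y sums to zero, add up to
minus a second moment. -/
theorem expect_perm_mul_nonpos (y : Fin n → ℝ) (hy : ∑ j, y j = 0) {i l : Fin n} (hil : i ≠ l) :
    𝔼 σ : Equiv.Perm (Fin n), y (σ i) * y (σ l) ≤ 0 := by
  have h : ∀ k ∈ univ.erase i, 𝔼 σ : Equiv.Perm (Fin n), y (σ i) * y (σ k) =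
      𝔼 σ : Equiv.Perm (Fin n), y (σ i) * y (σ l) := by
    intro k hk
    rw [← expect_comp_mul_right (Equiv.swap l k)]
    simp [Equiv.swap_apply_of_ne_of_ne hil (ne_of_mem_erase hk).symm]
  have h1 : ∑ k, 𝔼 σ : Equiv.Perm (Fin n), y (σ i) * y (σ k) = 0 := by
    rw [← expect_sum_comm]
    simp_rw [← mul_sum, Equiv.sum_comp, hy]
    simp
  rw [← add_sum_erase _ _ (mem_univ i), sum_congr rfl h, sum_const, nsmul_eq_mul] at h1
  have h2 : 0 ≤ 𝔼 σ : Equiv.Perm (Fin n), y (σ i) * y (σ i) :=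
    expect_nonneg fun σ _ => mul_self_nonneg _
  have h3 : (0 : ℝ) < #(univ.erase i) := by
    exact_mod_cast card_pos.2 ⟨l, mem_erase.2 ⟨hil.symm, mem_univ _⟩⟩
  by_contra hcon
  push Not at hcon
  have := mul_pos h3 hcon
  linarith

/-- The variance of a sample mean under sampling without replacement. -/
theorem expect_sq_average_le (y : Fin n → ℝ) (hy : ∑ j, y j = 0) {Y : ℝ} (hY : ∀ j, |y j| ≤ Y)
    {t : ℕ} (ht0 : 0 < t) (ht : t ≤ n) :
    𝔼 σ : Equiv.Perm (Fin n), ((1 / (t : ℝ)) * ∑ j : Fin t, y (σ (Fin.castLE ht j))) ^ 2 ≤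
      Y ^ 2 / t := by
  have htr : (0 : ℝ) < t := by exact_mod_cast ht0
  have h1 : ∀ i l : Fin t, 𝔼 σ : Equiv.Perm (Fin n),
      y (σ (Fin.castLE ht i)) * y (σ (Fin.castLE ht l)) ≤ if i = l then Y ^ 2 else 0 := by
    intro i l
    split_ifs with h
    · subst h
      refine expect_le univ_nonempty fun σ _ => ?_
      rw [← sq, ← sq_abs]
      exact pow_le_pow_left₀ (abs_nonneg _) (hY _) 2
    · exact expect_perm_mul_nonpos y hy fun h' => h (Fin.castLE_injective ht h')
  have h2 : 𝔼 σ : Equiv.Perm (Fin n), (∑ j : Fin t, y (σ (Fin.castLE ht j))) ^ 2 ≤ t * Y ^ 2 := by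
    simp_rw [sq (∑ j : Fin t, _), sum_mul_sum]
    rw [expect_sum_comm]
    simp_rw [expect_sum_comm]
    refine (sum_le_sum fun i _ => sum_le_sum fun l _ => h1 i l).trans ?_
    simp
  simp_rw [mul_pow]
  rw [← mul_expect]
  calc (1 / (t : ℝ)) ^ 2 * _ ≤ (1 / (t : ℝ)) ^ 2 * (t * Y ^ 2) := by gcongr
    _ = Y ^ 2 / t := by field_simp

/-- The mean Euclidean deviation of the sample means of several quantities. -/
theorem expect_sqrt_sum_sq_average_le {m : ℕ} (hm : 1 ≤ m) (y : Fin m → Fin n → ℝ)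
    (hy : ∀ i, ∑ j, y i j = 0) {Y : ℝ} (hY0 : 0 < Y) (hY : ∀ i j, |y i j| ≤ Y)
    {t : ℕ} (ht0 : 0 < t) (ht : t ≤ n) :
    𝔼 σ : Equiv.Perm (Fin n), Real.sqrt (∑ i : Fin m,
      ((1 / (t : ℝ)) * ∑ j : Fin t, y i (σ (Fin.castLE ht j))) ^ 2) ≤
      Y * (Real.sqrt m / Real.sqrt t) := by
  have htr : (0 : ℝ) < t := by exact_mod_cast ht0
  have hmr : (0 : ℝ) < m := by exact_mod_cast hm
  set c := Y * (Real.sqrt m / Real.sqrt t) with hc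
  have hc0 : 0 < c := by positivity
  have hc2 : c ^ 2 = m * (Y ^ 2 / t) := by
    rw [hc, mul_pow, div_pow, Real.sq_sqrt hmr.le, Real.sq_sqrt htr.le]; ring
  -- AM-GM with the target bound c as parameter, in place of Jensen's inequality for the square
  -- root.
  have hs : ∀ u : ℝ, 0 ≤ u → Real.sqrt u ≤ (1 / (2 * c)) * u + c / 2 := by
    intro u hu
    have h1 := Real.sq_sqrt hu
    have h2 : (1 / (2 * c)) * u + c / 2 - Real.sqrt u = (Real.sqrt u - c) ^ 2 / (2 * c) := by
      field_simp
      nlinarith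
    have h3 : 0 ≤ (Real.sqrt u - c) ^ 2 / (2 * c) := by positivity
    linarith
  refine (expect_le_expect fun σ _ => hs _ (sum_nonneg fun i _ => sq_nonneg _)).trans ?_
  rw [expect_add_distrib, Fintype.expect_const, ← mul_expect, expect_sum_comm]
  have h1 : ∑ i : Fin m, 𝔼 σ : Equiv.Perm (Fin n),
      ((1 / (t : ℝ)) * ∑ j : Fin t, y i (σ (Fin.castLE ht j))) ^ 2 ≤ c ^ 2 := by
    rw [hc2]
    refine (sum_le_sum fun i _ => expect_sq_average_le (y i) (hy i) (hY i) ht0 ht).trans ?_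
    simp
  calc _ ≤ 1 / (2 * c) * c ^ 2 + c / 2 := by gcongr
    _ = c := by field_simp; ring

end Sampling

/-! ### Per-period losses and their sum -/

section Regret

variable {m n : ℕ}

/-- The rate at which the per-period loss decays, up to the factor `√m`. -/
noncomputable def rate (n t : ℕ) : ℝ := 1 / Real.sqrt (t + 1) + 1 / Real.sqrt (n - t)

theorem sum_one_div_sqrt_le (n : ℕ) :
    ∑ t ∈ range n, 1 / Real.sqrt ((t : ℝ) + 1) ≤ 2 * Real.sqrt n := by
  induction n with
  | zero => simp
  | succ k ih =>
    rw [sum_range_succ]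
    have h1 : 1 / Real.sqrt ((k : ℝ) + 1) ≤ 2 * Real.sqrt (k + 1) - 2 * Real.sqrt k := by
      have hs : 0 < Real.sqrt ((k : ℝ) + 1) := Real.sqrt_pos.2 (by positivity)
      rw [div_le_iff₀ hs]
      have e1 := Real.sq_sqrt (by positivity : (0 : ℝ) ≤ (k : ℝ) + 1)
      have e2 := Real.sq_sqrt (by positivity : (0 : ℝ) ≤ (k : ℝ))
      nlinarith [sq_nonneg (Real.sqrt ((k : ℝ) + 1) - Real.sqrt k)]
    push_cast
    linarith

theorem sum_rate_le (n : ℕ) : ∑ t : Fin n, rate n t ≤ 4 * Real.sqrt n := by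
  rw [Fin.sum_univ_eq_sum_range (fun t => rate n t)]
  simp only [rate]
  rw [sum_add_distrib]
  have h := sum_one_div_sqrt_le n
  have h1 : ∑ t ∈ range n, 1 / Real.sqrt ((n : ℝ) - t) =
      ∑ t ∈ range n, 1 / Real.sqrt ((t : ℝ) + 1) := by
    rw [← sum_range_reflect]
    refine sum_congr rfl fun t ht => ?_
    rw [mem_range] at ht
    rw [show n - 1 - t = n - (t + 1) by omega, Nat.cast_sub (by omega)]
    push_cast
    congr 2
    ring
  rw [h1]
  linarith

/-- The shift to t + 1 in `rate` covers the first period, where 1/√t would be zero by convention; it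
costs a factor 2. -/
theorem one_div_sqrt_add_le_rate {n t : ℕ} (ht : 0 < t) :
    1 / Real.sqrt t + 1 / Real.sqrt (n - t) ≤ 2 * rate n t := by
  have htr : (1 : ℝ) ≤ t := by exact_mod_cast ht
  have h1 : 1 / Real.sqrt t ≤ 2 * (1 / Real.sqrt (t + 1)) := by
    have hs : Real.sqrt ((t : ℝ) + 1) ≤ 2 * Real.sqrt t := by
      rw [Real.sqrt_le_left (by positivity), mul_pow, Real.sq_sqrt (by positivity)]
      linarith
    have hp : 0 < Real.sqrt ((t : ℝ) + 1) := Real.sqrt_pos.2 (by positivity)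
    have hq : 0 < Real.sqrt (t : ℝ) := Real.sqrt_pos.2 (by positivity)
    rw [mul_one_div, div_le_div_iff₀ hq hp]
    linarith
  have h2 : 0 ≤ 1 / Real.sqrt ((n : ℝ) - t) := by positivity
  unfold rate
  linarith

/-- Bounds the share of ties through K² ≤ mt, so that early periods with t < m cause no loss beyond
the rate. -/
theorem min_div_le_sqrt {m t K : ℕ} (ht : 0 < t) (h1 : K ≤ m) (h2 : K ≤ t) :
    (K : ℝ) / t ≤ Real.sqrt m / Real.sqrt t := by
  have htr : (0 : ℝ) < t := by exact_mod_cast ht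
  rw [← Real.sqrt_div' _ htr.le]
  refine Real.le_sqrt_of_sq_le ?_
  rw [div_pow, div_le_div_iff₀ (by positivity) htr]
  have h : (K : ℝ) * K ≤ m * t := by exact_mod_cast Nat.mul_le_mul h1 h2
  nlinarith

theorem card_ties_le {D : Fin n → Column m} (hD : GeneralPosition D) {t : ℕ}
    (f : Fin t → Fin n) (hf : Function.Injective f) {p : Fin m → ℝ} (hp : ∀ i, 0 ≤ p i) :
    #(ties (fun j => D (f j)) p) ≤ m := by
  classical
  refine le_trans ?_ (hD p hp)
  refine card_le_card_of_injOn f (fun j hj => ?_) hf.injOn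
  simpa [ties] using hj

theorem dlaOutput_eq_accept (solve : (t : ℕ) → (Fin t → Column m) → (Fin m → ℝ))
    (z : Fin n → Column m) (t : Fin n) :
    dlaOutput solve z t = accept (z t) (dlaPrice solve z t) := rfl

/-- The constant in the per-period bounds. -/
noncomputable def periodConst (W dlow : ℝ) : ℝ := 2 * (41 * W + 2 * W * (W / dlow))

theorem periodConst_ge {W dlow : ℝ} (hW : 0 < W) (hd : 0 < dlow) :
    82 * W ≤ periodConst W dlow := by
  have : 0 ≤ 2 * W * (W / dlow) := by positivity
  unfold periodConst
  linarith

theorem one_le_rate_zero (n : ℕ) : 1 ≤ rate n 0 := by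
  have : 0 ≤ 1 / Real.sqrt ((n : ℝ) - (0 : ℕ)) := by positivity
  unfold rate
  simp only [Nat.cast_zero, zero_add, Real.sqrt_one, div_one] at this ⊢
  linarith

theorem abs_mul_accept_le {W a : ℝ} (ha : |a| ≤ W) (c : Column m) (p : Fin m → ℝ) :
    |a * accept c p| ≤ W := by
  rw [abs_mul, abs_of_nonneg (accept_nonneg c p)]
  exact (mul_le_of_le_one_right (abs_nonneg a) (accept_le_one c p)).trans ha

variable {D : Fin n → Column m} {d : Fin m → ℝ} {W dlow : ℝ}
  {solve : (t : ℕ) → (Fin t → Column m) → (Fin m → ℝ)}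

/-- The algorithm is nonanticipating; this is the hypothesis of `abs_expect_average_sub_next_le`. -/
theorem dlaPrice_comp_mul (t : Fin n) (σ τ : Equiv.Perm (Fin n)) (hτ : ∀ j < t, τ j = j) :
    dlaPrice solve (fun k => D ((σ * τ) k)) t = dlaPrice solve (fun k => D (σ k)) t := by
  unfold dlaPrice
  split_ifs with h
  · rfl
  · congr 1
    funext j
    show D (σ (τ _)) = D (σ _)
    rw [hτ _ (Fin.lt_def.2 j.isLt)]

theorem dlaPrice_isDualOptimal (hsolve : IsDualSolver d solve) (t : Fin n) (ht : 0 < t.val)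
    (z : Fin n → Column m) :
    IsDualOptimal d (fun j : Fin t.val => z (Fin.castLE t.isLt.le j)) (dlaPrice solve z t) := by
  unfold dlaPrice
  rw [if_neg ht.ne']
  exact hsolve _ _ ht

theorem expect_consumption_le (hm : 1 ≤ m) (hW : 0 < W) (hdlow : 0 < dlow)
    (hWa : ∀ j i, |(D j).2 i| ≤ W) (hd : ∀ i, dlow ≤ d i) (hD : GeneralPosition D)
    (hsolve : IsDualSolver d solve) (i : Fin m) (t : Fin n) :
    𝔼 σ : Equiv.Perm (Fin n), (D (σ t)).2 i * dlaOutput solve (fun k => D (σ k)) t ≤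
      d i + periodConst W dlow * Real.sqrt m * rate n t := by
  have hC := periodConst_ge hW hdlow
  have hC0 : 0 ≤ periodConst W dlow := by linarith
  have hsm : 1 ≤ Real.sqrt m := Real.one_le_sqrt.2 (by exact_mod_cast hm)
  simp_rw [dlaOutput_eq_accept]
  rcases Nat.eq_zero_or_pos t.val with h0 | ht
  -- The first price is not a dual solution, so the trivial bound W is paid once.
  · have h1 : 𝔼 σ : Equiv.Perm (Fin n), (D (σ t)).2 i *
        accept (D (σ t)) (dlaPrice solve (fun k => D (σ k)) t) ≤ W :=
      expect_le univ_nonempty fun σ _ => (le_abs_self _).trans (abs_mul_accept_le (hWa _ _) _ _)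
    have h2 : W ≤ periodConst W dlow * Real.sqrt m * rate n t := by
      rw [h0]
      have h3 := one_le_rate_zero n
      calc W ≤ periodConst W dlow * 1 * 1 := by linarith
        _ ≤ _ := by gcongr
    linarith [hd i]
  · set p : Equiv.Perm (Fin n) → Fin m → ℝ := fun σ => dlaPrice solve (fun k => D (σ k)) t
    have h := abs_expect_average_sub_next_le hm D (fun j => (D j).2 i) hW (fun j => hWa j i) t ht p
      fun σ τ hτ => dlaPrice_comp_mul t σ τ hτ
    have h1 : 𝔼 σ : Equiv.Perm (Fin n), (1 / (t.val : ℝ)) * ∑ j : Fin t.val,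
        (D (σ (Fin.castLE t.isLt.le j))).2 i * accept (D (σ (Fin.castLE t.isLt.le j))) (p σ) ≤
        d i + W * (Real.sqrt m / Real.sqrt t.val) := by
      refine expect_le univ_nonempty fun σ _ => ?_
      have hopt := dlaPrice_isDualOptimal hsolve t ht (fun k => D (σ k))
      refine (hopt.average_consumption_le i (W := W) fun j => hWa _ _).trans ?_
      have hK := card_ties_le hD (fun j => σ (Fin.castLE t.isLt.le j))
        (σ.injective.comp (Fin.castLE_injective _)) hopt.1
      have := min_div_le_sqrt ht hK (by simpa using card_le_univ (ties _ _))
      gcongr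
    have h2 := (abs_le.1 h).1
    have h3 := one_div_sqrt_add_le_rate (n := n) ht
    have h4 : W * (Real.sqrt m / Real.sqrt t.val) ≤
        W * Real.sqrt m * (1 / Real.sqrt t.val + 1 / Real.sqrt (n - t.val)) := by
      have : 0 ≤ W * Real.sqrt m * (1 / Real.sqrt ((n : ℝ) - t.val)) := by positivity
      rw [mul_add]
      have e : W * (Real.sqrt m / Real.sqrt t.val) =
        W * Real.sqrt m * (1 / Real.sqrt t.val) := by ring
      linarith
    have h5 : 41 * W * Real.sqrt m * (1 / Real.sqrt t.val + 1 / Real.sqrt (n - t.val)) ≤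
        periodConst W dlow * Real.sqrt m * rate n t := by
      have h6 : 0 ≤ 1 / Real.sqrt t.val + 1 / Real.sqrt ((n : ℝ) - t.val) := by positivity
      calc _ ≤ 41 * W * Real.sqrt m * (2 * rate n t) := by gcongr
        _ = 82 * W * Real.sqrt m * rate n t := by ring
        _ ≤ _ := by
          have : 0 ≤ rate n t := by linarith
          gcongr
    show 𝔼 σ : Equiv.Perm (Fin n), (D (σ t)).2 i * accept (D (σ t)) (p σ) ≤ _
    linarith

/-- A feasible x restricted to the sample is an unbiased benchmark: its mean sample reward is its
full average. Weak duality on the sample then suffices, and strong duality is never used. -/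
theorem le_expect_reward (hm : 1 ≤ m) (hW : 0 < W) (hdlow : 0 < dlow)
    (hWr : ∀ j, |(D j).1| ≤ W) (hWa : ∀ j i, |(D j).2 i| ≤ W) (hd : ∀ i, dlow ≤ d i)
    (hD : GeneralPosition D) (hsolve : IsDualSolver d solve) {x : Fin n → ℝ}
    (hx : x ∈ primalFeasible D fun i => (n : ℝ) * d i) (t : Fin n) :
    (∑ j, (D j).1 * x j) / n - periodConst W dlow * Real.sqrt m * rate n t ≤
      𝔼 σ : Equiv.Perm (Fin n), (D (σ t)).1 * dlaOutput solve (fun k => D (σ k)) t := by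
  have hC := periodConst_ge hW hdlow
  have hC0 : 0 ≤ periodConst W dlow := by linarith
  have hsm : 1 ≤ Real.sqrt m := Real.one_le_sqrt.2 (by exact_mod_cast hm)
  have hn0 : 0 < n := t.pos
  have hn : (0 : ℝ) < n := by exact_mod_cast hn0
  have hxa : ∀ a : ℝ, |a| ≤ W → ∀ j, |a * x j| ≤ W := fun a ha j => by
    rw [abs_mul, abs_of_nonneg (hx.1 j).1]
    exact (mul_le_of_le_one_right (abs_nonneg a) (hx.1 j).2).trans ha
  simp_rw [dlaOutput_eq_accept]
  rcases Nat.eq_zero_or_pos t.val with h0 | ht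
  · have h1 : -W ≤ 𝔼 σ : Equiv.Perm (Fin n), (D (σ t)).1 *
        accept (D (σ t)) (dlaPrice solve (fun k => D (σ k)) t) :=
      le_expect univ_nonempty fun σ _ =>
        (abs_le.1 (abs_mul_accept_le (hWr _) _ _)).1
    have h2 : 2 * W ≤ periodConst W dlow * Real.sqrt m * rate n t := by
      rw [h0]
      have h3 := one_le_rate_zero n
      calc 2 * W ≤ periodConst W dlow * 1 * 1 := by linarith
        _ ≤ _ := by gcongr
    have h3 : (∑ j, (D j).1 * x j) / n ≤ W := by
      rw [div_le_iff₀ hn]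
      have := sum_le_card_nsmul univ (fun j => (D j).1 * x j) W fun j _ =>
        (le_abs_self _).trans (hxa _ (hWr j) j)
      rw [card_univ, Fintype.card_fin, nsmul_eq_mul] at this
      linarith
    linarith
  · set p : Equiv.Perm (Fin n) → Fin m → ℝ := fun σ => dlaPrice solve (fun k => D (σ k)) t
    have h := abs_expect_average_sub_next_le hm D (fun j => (D j).1) hW hWr t ht p
      fun σ τ hτ => dlaPrice_comp_mul t σ τ hτ
    have htr : (0 : ℝ) < t.val := by exact_mod_cast ht
    set mean : Fin m → ℝ := fun i => (∑ j, (D j).2 i * x j) / n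
    -- Centring gives the zero sums needed for the variance bound, while feasibility of x gives mean
    -- i ≤ d i, the budget condition of weak duality.
    set y : Fin m → Fin n → ℝ := fun i j => (D j).2 i * x j - mean i
    have hmean : ∀ i, |mean i| ≤ W := by
      intro i
      simp only [mean]
      rw [abs_div, abs_of_pos hn, div_le_iff₀ hn]
      refine (abs_sum_le_sum_abs _ _).trans ?_
      have := sum_le_card_nsmul univ (fun j => |(D j).2 i * x j|) W fun j _ => hxa _ (hWa j i) j
      rw [card_univ, Fintype.card_fin, nsmul_eq_mul] at this
      linarith
    have hy0 : ∀ i, ∑ j, y i j = 0 := by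
      intro i
      simp only [y, mean, sum_sub_distrib, sum_const, card_univ, Fintype.card_fin, nsmul_eq_mul]
      field_simp
      ring
    have hy2 : ∀ i j, |y i j| ≤ 2 * W := fun i j =>
      (abs_sub _ _).trans (by linarith [hmean i, hxa _ (hWa j i) j])
    have hdev := expect_sqrt_sum_sq_average_le hm y hy0 (by positivity : 0 < 2 * W) hy2 ht t.isLt.le
    have hpt : ∀ σ : Equiv.Perm (Fin n),
        (1 / (t.val : ℝ)) * ∑ j : Fin t.val, (D (σ (Fin.castLE t.isLt.le j))).1 *
          x (σ (Fin.castLE t.isLt.le j)) -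
        (W / dlow) * Real.sqrt (∑ i : Fin m,
          ((1 / (t.val : ℝ)) * ∑ j : Fin t.val, y i (σ (Fin.castLE t.isLt.le j))) ^ 2) -
        W * (Real.sqrt m / Real.sqrt t.val) ≤
        (1 / (t.val : ℝ)) * ∑ j : Fin t.val, (D (σ (Fin.castLE t.isLt.le j))).1 *
          accept (D (σ (Fin.castLE t.isLt.le j))) (p σ) := by
      intro σ
      have hopt := dlaPrice_isDualOptimal hsolve t ht (fun k => D (σ k))
      refine le_trans ?_ (hopt.le_average_reward (W := W) fun j => hWr _)
      have hK := card_ties_le hD (fun j => σ (Fin.castLE t.isLt.le j))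
        (σ.injective.comp (Fin.castLE_injective _)) hopt.1
      have h1 := min_div_le_sqrt ht hK (by simpa using card_le_univ (ties _ _))
      have h2 := le_dualObjective (d := d)
        (z := fun j : Fin t.val => D (σ (Fin.castLE t.isLt.le j))) hopt.1
        (x := fun j => x (σ (Fin.castLE t.isLt.le j))) (fun j => hx.1 _)
        (fun i => (1 / (t.val : ℝ)) * ∑ j : Fin t.val, y i (σ (Fin.castLE t.isLt.le j)))
        (fun i => by
          have e : (1 / (t.val : ℝ)) * ∑ j : Fin t.val, y i (σ (Fin.castLE t.isLt.le j)) =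
              (1 / (t.val : ℝ)) * ∑ j : Fin t.val, (D (σ (Fin.castLE t.isLt.le j))).2 i *
                x (σ (Fin.castLE t.isLt.le j)) - mean i := by
            simp only [y, sum_sub_distrib, sum_const, card_univ, Fintype.card_fin, nsmul_eq_mul]
            field_simp
          rw [e, sub_sub_cancel]
          simp only [mean]
          rw [div_le_iff₀ hn, mul_comm]
          exact hx.2 i)
        (hopt.sum_price_le ht (fun j => hWr _) hdlow hd)
      have h3 := mul_le_mul_of_nonneg_left h1 hW.le
      exact sub_le_sub h2 h3
    have h1 := expect_le_expect (s := (univ : Finset (Equiv.Perm (Fin n)))) fun σ _ => hpt σ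
    rw [expect_sub_distrib, expect_sub_distrib, Fintype.expect_const, ← mul_expect, ← mul_expect,
      expect_sum_comm] at h1
    have h2 : (1 / (t.val : ℝ)) * ∑ j : Fin t.val, 𝔼 σ : Equiv.Perm (Fin n),
        (D (σ (Fin.castLE t.isLt.le j))).1 * x (σ (Fin.castLE t.isLt.le j)) =
        (∑ j, (D j).1 * x j) / n := by
      have e : ∀ i : Fin n, 𝔼 σ : Equiv.Perm (Fin n), (D (σ i)).1 * x (σ i) =
          (∑ j, (D j).1 * x j) / n := by
        intro i
        rw [eq_div_iff hn.ne', mul_comm]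
        exact expect_perm_apply (fun j => (D j).1 * x j) i
      rw [sum_congr rfl fun j _ => e _, sum_const, card_univ, Fintype.card_fin, nsmul_eq_mul]
      field_simp
    rw [h2] at h1
    have h3 := (abs_le.1 h).2
    have h4 := one_div_sqrt_add_le_rate (n := n) ht
    have h5 := mul_le_mul_of_nonneg_left hdev (by positivity : 0 ≤ W / dlow)
    have h6 : 0 ≤ (W + 2 * W * (W / dlow)) * Real.sqrt m *
        (1 / Real.sqrt ((n : ℝ) - t.val)) := by positivity
    -- The 41 W is 40 W from symmetrization plus W from ties; the other term is the price bound
    -- W/dlow times the deviation bound 2 W.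
    have h7 : (41 * W + 2 * W * (W / dlow)) * Real.sqrt m *
        (1 / Real.sqrt t.val + 1 / Real.sqrt (n - t.val)) ≤
        periodConst W dlow * Real.sqrt m * rate n t := by
      calc _ ≤ (41 * W + 2 * W * (W / dlow)) * Real.sqrt m * (2 * rate n t) := by gcongr
        _ = _ := by unfold periodConst; ring
    have h8 : (41 * W + 2 * W * (W / dlow)) * Real.sqrt m *
        (1 / Real.sqrt t.val + 1 / Real.sqrt (n - t.val)) =
        40 * W * Real.sqrt m * (1 / Real.sqrt t.val + 1 / Real.sqrt (n - t.val)) +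
        W * (Real.sqrt m / Real.sqrt t.val) +
        W / dlow * (2 * W * (Real.sqrt m / Real.sqrt t.val)) +
        (W + 2 * W * (W / dlow)) * Real.sqrt m * (1 / Real.sqrt ((n : ℝ) - t.val)) := by ring
    show _ ≤ 𝔼 σ : Equiv.Perm (Fin n), (D (σ t)).1 * accept (D (σ t)) (p σ)
    linarith

theorem primalValue_sub_expect_dlaReward_le (hm : 1 ≤ m) (hn : 1 ≤ n) (hW : 0 < W)
    (hdlow : 0 < dlow) (hWr : ∀ j, |(D j).1| ≤ W) (hWa : ∀ j i, |(D j).2 i| ≤ W)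
    (hd : ∀ i, dlow ≤ d i) (hD : GeneralPosition D) (hsolve : IsDualSolver d solve) :
    primalValue D (fun i => (n : ℝ) * d i) -
        𝔼 σ : Equiv.Perm (Fin n), dlaReward solve (fun t => D (σ t)) ≤
      4 * periodConst W dlow * Real.sqrt (m * n) := by
  have hC : 0 ≤ periodConst W dlow := by linarith [periodConst_ge hW hdlow]
  have hnr : (0 : ℝ) < n := by exact_mod_cast hn
  rw [sub_le_iff_le_add]
  refine csSup_le (Set.Nonempty.image _ ⟨fun _ => 0, ?_, ?_⟩) ?_
  · simp
  · intro i
    have := hd i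
    simp only [mul_zero, sum_const_zero]
    exact mul_nonneg hnr.le (by linarith)
  · rintro _ ⟨x, hx, rfl⟩
    have h := sum_le_sum fun t (_ : t ∈ univ) =>
      le_expect_reward hm hW hdlow hWr hWa hd hD hsolve hx t
    rw [sum_sub_distrib, ← mul_sum, ← expect_sum_comm, sum_const, card_univ, Fintype.card_fin,
      nsmul_eq_mul, mul_div_cancel₀ _ hnr.ne'] at h
    have h1 : periodConst W dlow * Real.sqrt m * ∑ t : Fin n, rate n t ≤
        4 * periodConst W dlow * Real.sqrt (m * n) := by
      calc _ ≤ periodConst W dlow * Real.sqrt m * (4 * Real.sqrt n) := by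
            gcongr; exact sum_rate_le n
        _ = _ := by rw [Real.sqrt_mul (by positivity)]; ring
    simp only [dlaReward]
    linarith

theorem expect_dlaExcess_le (hm : 1 ≤ m) (hW : 0 < W) (hdlow : 0 < dlow)
    (hWa : ∀ j i, |(D j).2 i| ≤ W) (hd : ∀ i, dlow ≤ d i) (hD : GeneralPosition D)
    (hsolve : IsDualSolver d solve) (i : Fin m) :
    𝔼 σ : Equiv.Perm (Fin n), dlaExcess solve (fun t => D (σ t)) (fun i => (n : ℝ) * d i) i ≤
      4 * periodConst W dlow * Real.sqrt (m * n) := by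
  have hC : 0 ≤ periodConst W dlow := by linarith [periodConst_ge hW hdlow]
  have h := sum_le_sum fun t (_ : t ∈ univ) =>
    expect_consumption_le hm hW hdlow hWa hd hD hsolve i t
  rw [sum_add_distrib, ← mul_sum, ← expect_sum_comm, sum_const, card_univ, Fintype.card_fin,
    nsmul_eq_mul] at h
  have h1 : periodConst W dlow * Real.sqrt m * ∑ t : Fin n, rate n t ≤
      4 * periodConst W dlow * Real.sqrt (m * n) := by
    calc _ ≤ periodConst W dlow * Real.sqrt m * (4 * Real.sqrt n) := by
          gcongr; exact sum_rate_le n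
      _ = _ := by rw [Real.sqrt_mul (by positivity)]; ring
  simp only [dlaExcess]
  rw [expect_sub_distrib, Fintype.expect_const]
  linarith

end Regret

end OnlineLP

theorem theorem4 (rbar abar dlow dbar : ℝ) (hdlow : 0 < dlow) :
    ∃ C : ℝ, ∀ (m n : ℕ), 1 ≤ m → 1 ≤ n →
      ∀ (D : Fin n → OnlineLP.Column m) (d : Fin m → ℝ),
        (∀ j, |(D j).1| ≤ rbar) →
        (∀ j i, |(D j).2 i| ≤ abar) →
        (∀ i, dlow ≤ d i ∧ d i ≤ dbar) →
        OnlineLP.GeneralPosition D →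
        ∀ solve : (t : ℕ) → (Fin t → OnlineLP.Column m) → (Fin m → ℝ),
          OnlineLP.IsDualSolver d solve →
          OnlineLP.primalValue D (fun i => (n : ℝ) * d i)
              - (𝔼 σ : Equiv.Perm (Fin n), OnlineLP.dlaReward solve (fun t => D (σ t)))
            ≤ C * Real.sqrt ((m : ℝ) * (n : ℝ)) ∧
          (2 ≤ n → ∀ i : Fin m,
            (𝔼 σ : Equiv.Perm (Fin n),
              OnlineLP.dlaExcess solve (fun t => D (σ t)) (fun i => (n : ℝ) * d i) i)
            ≤ C * (Real.sqrt ((m : ℝ) * (n : ℝ)) * Real.log (n : ℝ))) := by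
  -- The summand 1 keeps W positive, as rescaling the weights by W requires.
  set W : ℝ := max |rbar| |abar| + 1
  have hW : 0 < W := by positivity
  have hr : rbar ≤ W := by
    have := (le_abs_self rbar).trans (le_max_left |rbar| |abar|)
    simp only [W]; linarith
  have ha : abar ≤ W := by
    have := (le_abs_self abar).trans (le_max_right |rbar| |abar|)
    simp only [W]; linarith
  have hC : 0 ≤ OnlineLP.periodConst W dlow := by linarith [OnlineLP.periodConst_ge hW hdlow]
  -- Both bounds hold with factor 4; doubling it absorbs log n ≥ 1/2 for n ≥ 2.
  refine ⟨8 * OnlineLP.periodConst W dlow, ?_⟩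
  intro m n hm hn D d hDr hDa hd hD solve hsolve
  have hWr : ∀ j, |(D j).1| ≤ W := fun j => (hDr j).trans hr
  have hWa : ∀ j i, |(D j).2 i| ≤ W := fun j i => (hDa j i).trans ha
  have hd' : ∀ i, dlow ≤ d i := fun i => (hd i).1
  have hs := mul_nonneg hC (Real.sqrt_nonneg ((m : ℝ) * (n : ℝ)))
  refine ⟨?_, fun hn2 i => ?_⟩
  · refine (OnlineLP.primalValue_sub_expect_dlaReward_le hm hn hW hdlow hWr hWa hd' hD
      hsolve).trans ?_
    linarith
  · refine (OnlineLP.expect_dlaExcess_le hm hW hdlow hWa hd' hD hsolve i).trans ?_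
    have hlog : 1 / 2 ≤ Real.log n := by
      have h1 := Real.log_le_log (by norm_num) (by exact_mod_cast hn2 : (2 : ℝ) ≤ n)
      linarith [Real.log_two_gt_d9]
    nlinarith
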